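/- For \(r>1\) let \(D_r=\{(x,y)\in\mathbb R^2: x^2+(y-\tfrac{r+1}{2})^2<\tfrac{(r-1)^2}{4}\}\), and let \(C_0^\infty(D_r)\) be the set of smooth functions \(f:\mathbb R^2\to\mathbb R\) with compact support contained in \(D_r\). For \(p>0\) and an angle \(\phi\) let \(\mathcal D_1f(p,\phi)\) be the integral of \(f\) over the disc of diameter \(1/p\) whose centre has polar coordinates \((\tfrac1{2p},\phi)\) (so that its boundary passes through the origin), and let \(\mathcal D_1f(0^+,\phi)=\lim_{p\to0^+}\mathcal D_1f(p,\phi)\). Put \[ \mathcal D_2f(p,\phi)=\begin{cases}\mathcal D_1f(p,\phi),&p>0,\\ \tfrac12\big(\mathcal D_1f(0^+,\phi)+\mathcal D_1f(0^+,\phi+\pi)\big),&p=0,\\ \mathcal D_1f(-p,\phi+\pi),&p<0,\end{cases} \] and define the disc transform on \(\mathbb R\times S^1\) by \[ \mathcal Df(p,\phi)=\mathcal D_2f(p,\phi)+\tfrac12\big(\mathcal D_1f(0^+,\phi+\pi)-\mathcal D_1f(0^+,\phi)\big)\,\mathrm{sgn}(p). \] With \(\hat f(\xi)=\frac1{2\pi}\int_{\mathbb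 R^2}f(x)e^{-ix\cdot\xi}\,dx\), let \(\|f\|_{H^\beta}^2=\int_{\mathbb R^2}(1+|\xi|^2)^\beta|\hat f(\xi)|^2\,d\xi\). **Theorem.** Let \(r>1\) and \(0<\beta<1\). There is a constant \(c>0\), depending only on \(\beta\) and on the fixed radius parameter \(r\), such that for every \(\rho\ge0\) and every \(f\in C_0^\infty(D_r)\) with \(\|f\|_{H^\beta}\le\rho\), the function \(\mathcal Df\) lies in \(L^2([-1,1]\times S^1)\) and \[ \|f\|_{L^2(\mathbb R^2)}\le c\,\rho^{\frac{3/2}{\beta+3/2}}\,\|\mathcal Df\|_{L^2([-1,1]\times S^1)}^{\frac{\beta}{\beta+3/2}}, \] where \(\|\mathcal Df\|_{L^2([-1,1]\times S^1)}^2=\int_0^{2\pi}\int_{-1}^{1}|\mathcal Df(p,\phi)|^2\,dp\,d\phi\). -/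

import Mathlib

open MeasureTheory Filter Topology
open scoped ContDiff ENNReal

noncomputable section

namespace DiscTransform

/-- The Euclidean plane `ℝ²`. -/
abbrev Plane : Type := EuclideanSpace ℝ (Fin 2)

/-- The unit vector `(cos φ, sin φ)`. -/
def dir (φ : ℝ) : Plane := !₂[Real.cos φ, Real.sin φ]

/-- The disc of diameter `d > 0` whose boundary passes through the origin and whose centre has
polar coordinates `(d / 2, φ)`. -/
def disc (d φ : ℝ) : Set Plane := Metric.ball ((d / 2) • dir φ) (d / 2)

/-- The disc transform `𝒟₁ f (p, φ)`, `p > 0`: the integral of `f` over the disc of diameter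
`1 / p` in direction `φ` whose boundary passes through the origin. -/
def discTransform₁ (f : Plane → ℝ) (p φ : ℝ) : ℝ := ∫ x in disc (1 / p) φ, f x

/-- The one-sided limit `𝒟₁ f (0⁺, φ)`. It exists for every integrable `f`
(`tendsto_discTransform₁`). -/
def discTransform₁ZeroPlus (f : Plane → ℝ) (φ : ℝ) : ℝ :=
  limUnder (𝓝[>] (0 : ℝ)) (fun p => discTransform₁ f p φ)

/-- The extension `𝒟₂ f` of `𝒟₁ f` to the cylinder `ℝ × S¹`; a point of `S¹` is given by its
angle `φ`. -/
def discTransform₂ (f : Plane → ℝ) (p φ : ℝ) : ℝ :=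
  if 0 < p then discTransform₁ f p φ
  else if p = 0 then
    (discTransform₁ZeroPlus f φ + discTransform₁ZeroPlus f (φ + Real.pi)) / 2
  else discTransform₁ f (-p) (φ + Real.pi)

/-- Half the jump of `𝒟₂ f (·, φ)` at `p = 0`. -/
def jump (f : Plane → ℝ) (φ : ℝ) : ℝ :=
  (discTransform₁ZeroPlus f (φ + Real.pi) - discTransform₁ZeroPlus f φ) / 2

/-- The disc transform `𝒟 f (p, φ) = 𝒟₂ f (p, φ) + c(φ) sgn p` on the cylinder `ℝ × S¹`. -/
def discTransform (f : Plane → ℝ) (p φ : ℝ) : ℝ :=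
  discTransform₂ f p φ + jump f φ * Real.sign p

/-- The measure `dp dφ` on `[-1, 1] × S¹`, where `S¹` is parametrized by `φ ∈ [0, 2π]`. -/
def cylinderMeasure : Measure (ℝ × ℝ) :=
  (volume : Measure (ℝ × ℝ)).restrict (Set.Icc (-1) 1 ×ˢ Set.Icc 0 (2 * Real.pi))

/-- The open disc `D_r = {(x, y) : x² + (y - (r + 1) / 2)² < (r - 1)² / 4}`. -/
def detectorDisc (r : ℝ) : Set Plane :=
  {x | x 0 ^ 2 + (x 1 - (r + 1) / 2) ^ 2 < (r - 1) ^ 2 / 4}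

/-- `f ∈ C₀^∞(Ω)`: `f` is smooth and has compact support contained in `Ω`. -/
def IsTestFunction (Ω : Set Plane) (f : Plane → ℝ) : Prop :=
  ContDiff ℝ ∞ f ∧ HasCompactSupport f ∧ tsupport f ⊆ Ω

/-- The Fourier transform `f̂(ξ) = (2π)⁻¹ ∫ f(x) e^{-i x·ξ} dx` on the plane. -/
def fourierHat (f : Plane → ℝ) (ξ : Plane) : ℂ :=
  (2 * Real.pi : ℂ)⁻¹ * ∫ x : Plane, (f x : ℂ) * Complex.exp (-Complex.I * (inner ℝ x ξ : ℝ))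

/-- The Sobolev norm `‖f‖_{H^α(ℝ²)} = (∫ (1 + |ξ|²)^α |f̂(ξ)|² dξ)^{1/2}`, with values in
`[0, ∞]`. -/
def sobolevNorm (α : ℝ) (f : Plane → ℝ) : ℝ≥0∞ :=
  (∫⁻ ξ : Plane, ENNReal.ofReal ((1 + ‖ξ‖ ^ 2) ^ α * ‖fourierHat f ξ‖ ^ 2)) ^ (1 / 2 : ℝ)

theorem mem_disc_iff {p : ℝ} (hp : 0 < p) (φ : ℝ) (x : Plane) :
    x ∈ disc (1 / p) φ ↔ p * ‖x‖ ^ 2 < inner ℝ x (dir φ) := by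
  have h1 : ‖dir φ‖ ^ 2 = 1 := by
    simp [dir, EuclideanSpace.norm_sq_eq, Fin.sum_univ_two]
  have hr : 0 < 1 / p / 2 := by positivity
  rw [disc, Metric.mem_ball, dist_eq_norm, ← sq_lt_sq₀ (norm_nonneg _) hr.le,
    norm_sub_sq_real, norm_smul, mul_pow, h1, inner_smul_right, Real.norm_eq_abs, sq_abs]
  constructor
  · intro h
    have h2 : ‖x‖ ^ 2 < 1 / p * inner ℝ x (dir φ) := by linarith
    have h3 := mul_lt_mul_of_pos_left h2 hp
    rwa [← mul_assoc, mul_one_div_cancel hp.ne', one_mul] at h3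
  · intro h
    have h3 := mul_lt_mul_of_pos_left h (one_div_pos.mpr hp)
    rw [← mul_assoc, one_div_mul_cancel hp.ne', one_mul] at h3
    linarith

/-- The limit `𝒟₁ f (0⁺, φ)` exists: it is the integral of `f` over a half-plane. -/
theorem tendsto_discTransform₁ {f : Plane → ℝ} (hf : Integrable f) (φ : ℝ) :
    Tendsto (fun p => discTransform₁ f p φ) (𝓝[>] 0)
      (𝓝 (∫ x in {x : Plane | 0 < inner ℝ x (dir φ)}, f x)) := by
  have hH : MeasurableSet {x : Plane | 0 < inner ℝ x (dir φ)} :=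
    (isOpen_lt continuous_const (by fun_prop)).measurableSet
  simp only [discTransform₁]
  rw [← integral_indicator hH]
  simp_rw [← integral_indicator (show MeasurableSet (disc (1 / _) φ) from measurableSet_ball)]
  refine tendsto_integral_filter_of_dominated_convergence (fun x => ‖f x‖) ?_ ?_ hf.norm ?_
  · exact Eventually.of_forall fun p => hf.aestronglyMeasurable.indicator measurableSet_ball
  · exact Eventually.of_forall fun p => Eventually.of_forall fun x => norm_indicator_le_norm_self _ _
  · refine Eventually.of_forall fun x => tendsto_const_nhds.congr' ?_
    by_cases hx : 0 < inner ℝ x (dir φ)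
    · have hc : Tendsto (fun p : ℝ => p * ‖x‖ ^ 2) (𝓝[>] 0) (𝓝 0) := by
        have : Continuous fun p : ℝ => p * ‖x‖ ^ 2 := by fun_prop
        simpa using (this.tendsto 0).mono_left nhdsWithin_le_nhds
      filter_upwards [hc.eventually_lt_const hx, self_mem_nhdsWithin] with p hp hp0
      rw [Set.indicator_of_mem (show x ∈ {x : Plane | 0 < inner ℝ x (dir φ)} from hx),
        Set.indicator_of_mem ((mem_disc_iff hp0 φ x).2 hp)]
    · filter_upwards [self_mem_nhdsWithin] with p hp0
      have hp0' : (0 : ℝ) < p := hp0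
      rw [Set.indicator_of_notMem (show x ∉ {x : Plane | 0 < inner ℝ x (dir φ)} from hx),
        Set.indicator_of_notMem]
      rw [mem_disc_iff hp0 φ x]
      have : 0 ≤ p * ‖x‖ ^ 2 := by positivity
      exact fun h => hx (this.trans_lt h)

end DiscTransform

end

/-! Inversion `x ↦ x / ‖x‖²` turns discs whose boundary passes through the origin into half-planes
`p < y · dir φ`. With the transported density `g = pullback f`, the corrected transform becomes `∫
g(y) kern(p, y · dir φ) dy` (`discTransform_eq_halfPlaneTransform`): adding the jump term leaves the
constant `1/2` minus the indicator of the strip between `0` and `p`.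

Multiplied by `sgn p`, this function has `p`-derivative `-Rg`, with `R` the Radon transform, apart
from a jump `∫ g` at `p = 0`. The Fourier slice theorem, integrated by parts over `[-1, 1]`,
therefore expresses the Fourier transform of `g` along the ray in direction `φ` by the frequency
times the transform of the data, plus `∫ g` and two boundary terms (`fourier_smul_dir`). The
inverted detector disc lies in the unit disc, off the origin and on one side of it, so these extra
terms are values that the data take on whole intervals of `p` and sets of `φ`, and are bounded by
the `L²` norm of the data. Integration in polar coordinates gives `‖g‖_{H^{-3/2}} ≤ C ‖𝒟f‖`
(`exists_lintegral_fourier_le`): one order from the derivative, one half from the polar Jacobian.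

Conversely `‖g‖_{H^β} ≤ C ‖f‖_{H^β}` (`exists_sobolev_pullback_le`). For `0 < β < 1` the `H^β` norm
is comparable to the `L²` norm plus a Gagliardo double integral, which survives the change of
variables because inversion is smooth with bounded distortion on an annulus around the support.
Interpolating `L²` between `H^{-3/2}` and `H^β` (`lintegral_interpolation`), and bounding `‖f‖` by
`‖g‖` in `L²`, finishes the proof. -/

namespace DiscTransform

/-! ### Plancherel's identity for the Fourier integral on `L¹ ∩ L²`. -/

section Plancherel

open FourierTransform SchwartzMap

variable {V : Type*} [NormedAddCommGroup V] [InnerProductSpace ℝ V] [FiniteDimensional ℝ V]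
  [MeasurableSpace V] [BorelSpace V]

theorem continuous_fourier {F : V → ℂ} (hF : Integrable F) : Continuous (𝓕 F) :=
  VectorFourier.fourierIntegral_continuous Real.continuous_fourierChar
    (by exact continuous_inner) hF

/-- The `L²` Fourier transform of a function in `L¹ ∩ L²` is given by the Fourier integral. -/
theorem fourier_toLp_ae_eq {F : V → ℂ} (h1 : Integrable F) (h2 : MemLp F 2) :
    (𝓕 (h2.toLp F) : Lp ℂ 2 (volume : Measure V)) =ᵐ[volume] 𝓕 F := by
  refine ae_eq_of_integral_contDiff_smul_eq ?_ ?_ ?_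
  · exact (Lp.memLp _).locallyIntegrable (by norm_num)
  · exact (continuous_fourier h1).locallyIntegrable
  intro ψ hψ hψc
  have hc : HasCompactSupport (fun x => (ψ x : ℂ)) := hψc.comp_left (g := Complex.ofReal) rfl
  set Ψ : 𝓢(V, ℂ) := hc.toSchwartzMap (Complex.ofRealCLM.contDiff.comp hψ)
  have hΨ : ∀ x, Ψ x = ψ x := fun x => rfl
  -- As a tempered distribution, the `L²` transform passes the Fourier transform to the test
  -- function; the multiplication formula for Fourier integrals (`e3`) passes it back to `F`.
  have e1 := DFunLike.congr_fun (Lp.fourier_toTemperedDistribution_eq (h2.toLp F)) Ψ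
  rw [TemperedDistribution.fourier_apply, Lp.toTemperedDistribution_apply,
    Lp.toTemperedDistribution_apply] at e1
  have e2 : ∫ x, (𝓕 Ψ) x • (h2.toLp F) x = ∫ x, (𝓕 Ψ) x • F x := by
    refine integral_congr_ae ?_
    filter_upwards [h2.coeFn_toLp] with x hx
    rw [hx]
  have e3 : ∫ x, (𝓕 (Ψ : V → ℂ)) x • F x = ∫ x, Ψ x • (𝓕 F) x :=
    by
      simpa using! VectorFourier.integral_bilin_fourierIntegral_eq_flip
        (ContinuousLinearMap.lsmul ℂ ℂ : ℂ →L[ℂ] ℂ →L[ℂ] ℂ) (L := innerₗ V)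
        Real.continuous_fourierChar continuous_inner (Ψ.integrable (μ := volume)) h1
  rw [e2, SchwartzMap.fourier_coe, e3] at e1
  simpa [hΨ] using e1.symm

/-- **Plancherel's theorem** for functions in `L¹ ∩ L²`. -/
theorem eLpNorm_fourier {F : V → ℂ} (h1 : Integrable F) (h2 : MemLp F 2) :
    eLpNorm (𝓕 F) 2 volume = eLpNorm F 2 volume := by
  rw [← eLpNorm_congr_ae (fourier_toLp_ae_eq h1 h2), ← eLpNorm_congr_ae h2.coeFn_toLp,
    ← Lp.enorm_def, ← Lp.enorm_def, ← ofReal_norm, Lp.norm_fourier_eq, ofReal_norm]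

theorem eLpNorm_two_sq {α E : Type*} [MeasurableSpace α] [NormedAddCommGroup E] (μ : Measure α)
    (F : α → E) : eLpNorm F 2 μ ^ 2 = ∫⁻ x, ‖F x‖ₑ ^ 2 ∂μ := by
  rw [eLpNorm_eq_lintegral_rpow_enorm_toReal (by norm_num) (by norm_num), ← ENNReal.rpow_natCast,
    ← ENNReal.rpow_mul]
  simp

theorem lintegral_enorm_fourier_sq {F : V → ℂ} (h1 : Integrable F) (h2 : MemLp F 2) :
    ∫⁻ ξ, ‖𝓕 F ξ‖ₑ ^ 2 = ∫⁻ x, ‖F x‖ₑ ^ 2 := by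
  rw [← eLpNorm_two_sq, ← eLpNorm_two_sq, eLpNorm_fourier h1 h2]

end Plancherel

/-! ### Inversion in the unit circle and its change of variables. -/

section Inversion

/-- The inversion `x ↦ x / ‖x‖²` of the punctured plane. -/
noncomputable def circInv (x : Plane) : Plane := (‖x‖ ^ 2)⁻¹ • x

theorem circInv_eq_inversion : circInv = EuclideanGeometry.inversion (0 : Plane) 1 := by
  ext1 x
  simp [circInv, EuclideanGeometry.inversion]

theorem norm_circInv (x : Plane) : ‖circInv x‖ = ‖x‖⁻¹ := by
  rw [circInv, norm_smul, norm_inv, norm_pow, norm_norm]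
  rcases eq_or_ne ‖x‖ 0 with h | h
  · simp [h]
  · field_simp

theorem circInv_circInv (x : Plane) : circInv (circInv x) = x := by
  rw [circInv_eq_inversion, EuclideanGeometry.inversion_inversion _ one_ne_zero]

theorem norm_circInv_sub_circInv {x y : Plane} (hx : x ≠ 0) (hy : y ≠ 0) :
    ‖circInv x - circInv y‖ = (‖x‖ * ‖y‖)⁻¹ * ‖x - y‖ := by
  have := EuclideanGeometry.dist_inversion_inversion hx hy 1
  rw [← circInv_eq_inversion] at this
  simpa [dist_eq_norm] using this

theorem measurable_circInv : Measurable circInv := by unfold circInv; fun_prop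

/-- The derivative of `circInv`. -/
noncomputable def circInvDeriv (x : Plane) : Plane →L[ℝ] Plane :=
  (1 / dist x 0) ^ 2 • (((ℝ ∙ (x - 0))ᗮ.reflection : Plane ≃L[ℝ] Plane) : Plane →L[ℝ] Plane)

theorem hasFDerivAt_circInv {x : Plane} (hx : x ≠ 0) : HasFDerivAt circInv (circInvDeriv x) x := by
  rw [circInv_eq_inversion]
  exact EuclideanGeometry.hasFDerivAt_inversion hx

/-- The derivative is `‖x‖⁻²` times a reflection; in dimension two the scalar contributes its square
and the reflection only a sign. -/
theorem abs_det_circInvDeriv (x : Plane) : |(circInvDeriv x).det| = (‖x‖ ^ 4)⁻¹ := by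
  have h : |LinearMap.det ((ℝ ∙ (x - 0))ᗮ.reflection.toLinearMap)| = 1 := by
    rw [Submodule.det_reflection]; simp
  have h2 : (circInvDeriv x).det = ((1 / dist x 0) ^ 2) ^ 2 *
      LinearMap.det ((ℝ ∙ (x - 0))ᗮ.reflection.toLinearMap) := by
    rw [ContinuousLinearMap.det, circInvDeriv, ContinuousLinearMap.toLinearMap_smul, LinearMap.det_smul,
      finrank_euclideanSpace_fin]
    rfl
  rw [h2, abs_mul, h, abs_of_nonneg (by positivity)]
  simp [← pow_mul]

theorem circInv_injective : Function.Injective circInv :=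
  Function.LeftInverse.injective circInv_circInv

theorem circInv_image_eq_preimage (s : Set Plane) : circInv '' s = circInv ⁻¹' s :=
  congrFun (Set.image_eq_preimage_of_inverse circInv_circInv circInv_circInv) s

theorem lintegral_circInv {s : Set Plane} (hs : MeasurableSet s) (h0 : (0 : Plane) ∉ s)
    (F : Plane → ℝ≥0∞) :
    ∫⁻ x in circInv ⁻¹' s, F x = ∫⁻ y in s, ENNReal.ofReal ((‖y‖ ^ 4)⁻¹) * F (circInv y) := by
  rw [← circInv_image_eq_preimage, lintegral_image_eq_lintegral_abs_det_fderiv_mul volume hs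
    (f' := circInvDeriv) (fun x hx => (hasFDerivAt_circInv fun h => h0 (h ▸ hx)).hasFDerivWithinAt)
    circInv_injective.injOn]
  simp_rw [abs_det_circInvDeriv]

theorem integral_circInv {E : Type*} [NormedAddCommGroup E] [NormedSpace ℝ E] (F : Plane → E) :
    ∫ x, F x = ∫ y, (‖y‖ ^ 4)⁻¹ • F (circInv y) := by
  have h1 := integral_image_eq_integral_abs_det_fderiv_smul volume
    (measurableSet_singleton (0 : Plane)).compl
    (f' := circInvDeriv) (fun x hx => (hasFDerivAt_circInv hx).hasFDerivWithinAt) circInv_injective.injOn F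
  have h2 : circInv '' {0}ᶜ = ({0}ᶜ : Set Plane) := by
    rw [circInv_image_eq_preimage]; ext x
    simp [circInv]
  rw [h2, ] at h1
  simp_rw [abs_det_circInvDeriv] at h1
  rwa [restrict_compl_singleton] at h1

/-- The annulus `1 / R ≤ ‖x‖ ≤ R`. -/
def annulus (R : ℝ) : Set Plane := {x | R⁻¹ ≤ ‖x‖ ∧ ‖x‖ ≤ R}

theorem measurableSet_annulus (R : ℝ) : MeasurableSet (annulus R) :=
  (measurableSet_le measurable_const measurable_norm).inter
    (measurableSet_le measurable_norm measurable_const)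

theorem ne_zero_of_mem_annulus {R : ℝ} (hR : 0 < R) {x : Plane} (hx : x ∈ annulus R) : x ≠ 0 := by
  rintro rfl
  have := hx.1
  simp only [norm_zero] at this
  exact absurd this (not_le.2 (by positivity))

/-- On the annulus the Jacobian `‖y‖⁻⁴` is at least `R⁻⁴`, so inserting it costs a factor `R ^ 4`.
-/
theorem setLIntegral_annulus_comp_circInv_le {R : ℝ} (hR : 0 < R) (F : Plane → ℝ≥0∞) :
    ∫⁻ y in annulus R, F (circInv y) ≤ ENNReal.ofReal (R ^ 4) * ∫⁻ x, F x := by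
  calc ∫⁻ y in annulus R, F (circInv y)
      ≤ ∫⁻ y in annulus R,
          ENNReal.ofReal (R ^ 4) * (ENNReal.ofReal ((‖y‖ ^ 4)⁻¹) * F (circInv y)) := by
        refine setLIntegral_mono' (measurableSet_annulus R) fun y hy => ?_
        rw [← mul_assoc, ← ENNReal.ofReal_mul (by positivity)]
        refine le_mul_of_one_le_left (zero_le) ?_
        rw [ENNReal.one_le_ofReal, ← div_eq_mul_inv]
        have hy0 : 0 < ‖y‖ := norm_pos_iff.2 (ne_zero_of_mem_annulus hR hy)
        rw [one_le_div (by positivity)]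
        exact pow_le_pow_left₀ hy0.le hy.2 4
    _ = ENNReal.ofReal (R ^ 4) * ∫⁻ x in circInv ⁻¹' annulus R, F x := by
        rw [lintegral_const_mul' _ _ ENNReal.ofReal_ne_top, lintegral_circInv (measurableSet_annulus R)
          fun h => ne_zero_of_mem_annulus hR h rfl]
    _ ≤ _ := by gcongr; exact Measure.restrict_le_self

end Inversion

/-! ### Polar coordinates in the plane. -/

section Polar

theorem norm_dir (φ : ℝ) : ‖dir φ‖ = 1 := by
  rw [← sq_eq_sq₀ (norm_nonneg _) zero_le_one]
  simp [dir, EuclideanSpace.norm_sq_eq, Fin.sum_univ_two]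

theorem dir_add_pi (φ : ℝ) : dir (φ + Real.pi) = -dir φ := by
  ext i; fin_cases i <;> simp [dir]

theorem continuous_dir : Continuous dir := by
  unfold dir
  fun_prop

theorem inner_dir (x : Plane) (φ : ℝ) :
    inner ℝ x (dir φ) = x 0 * Real.cos φ + x 1 * Real.sin φ := by
  simp [dir, PiLp.inner_apply, Fin.sum_univ_two, mul_comm]

theorem lintegral_polar_symm (F : Plane → ℝ≥0∞) :
    ∫⁻ x, F x = ∫⁻ z in Set.Ioi (0 : ℝ) ×ˢ Set.Ioo (-Real.pi) Real.pi,
      ENNReal.ofReal z.1 * F (z.1 • dir z.2) := by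
  have e := ((PiLp.volume_preserving_toLp (Fin 2)).comp
    (volume_preserving_finTwoArrow ℝ).symm)
  have e' : MeasurableEmbedding (WithLp.toLp 2 ∘ (MeasurableEquiv.finTwoArrow (α := ℝ)).symm) :=
    (MeasurableEquiv.toLp 2 (Fin 2 → ℝ)).measurableEmbedding.comp
      (MeasurableEquiv.measurableEmbedding _)
  rw [← e.lintegral_comp_emb e', ← lintegral_comp_polarCoord_symm]
  simp only [polarCoord_target, smul_eq_mul]
  congr 1; ext z; congr 2
  ext i; fin_cases i <;> simp [dir]

theorem lintegral_polar {F : Plane → ℝ≥0∞} (hF : Measurable F) :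
    ∫⁻ x, F x = ∫⁻ φ in Set.Ioo 0 (2 * Real.pi), ∫⁻ s in Set.Ioi (0 : ℝ),
      ENNReal.ofReal s * F (s • dir φ) := by
  -- Mathlib's polar angle runs over `(-π, π)`; the substitution `x ↦ -x` is a shift of the angle by
  -- `π`, which moves the range to `(0, 2π)`.
  have h1 : ∫⁻ x, F x = ∫⁻ x, F (-x) := (lintegral_neg_eq_self F).symm
  rw [h1, lintegral_polar_symm, Measure.volume_eq_prod, ← Measure.prod_restrict,
    lintegral_prod_symm]
  · have h3 := (measurePreserving_add_right volume Real.pi).setLIntegral_comp_preimage_emb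
      (measurableEmbedding_addRight Real.pi)
      (fun φ => ∫⁻ s in Set.Ioi (0 : ℝ), ENNReal.ofReal s * F (s • dir φ))
      (Set.Ioo 0 (2 * Real.pi))
    rw [← h3]
    have h4 : (fun φ => φ + Real.pi) ⁻¹' Set.Ioo 0 (2 * Real.pi) = Set.Ioo (-Real.pi) Real.pi := by
      ext; simp only [Set.mem_preimage, Set.mem_Ioo]; constructor <;> rintro ⟨_, _⟩ <;>
        constructor <;> linarith
    rw [h4]
    simp [dir_add_pi]
  · have := continuous_dir.measurable
    fun_prop

end Polar

/-! ### The step kernel and its integration by parts. -/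

section Kernel

/-- The kernel of the disc transform with respect to the signed distance `t` to the origin. -/
noncomputable def kern (p t : ℝ) : ℝ :=
  1 / 2 - if (0 < t ∧ t ≤ p) ∨ (p ≤ t ∧ t < 0) then 1 else 0

theorem abs_kern_le (p t : ℝ) : |kern p t| ≤ 1 / 2 := by
  unfold kern; split_ifs <;> norm_num [abs_le]

theorem measurable_kern : Measurable fun z : ℝ × ℝ => kern z.1 z.2 := by
  unfold kern
  refine measurable_const.sub (Measurable.ite ?_ measurable_const measurable_const)
  exact ((measurableSet_lt measurable_const measurable_snd).inter
    (measurableSet_le measurable_snd measurable_fst)).union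
    ((measurableSet_le measurable_fst measurable_snd).inter
    (measurableSet_lt measurable_snd measurable_const))

theorem kern_zero_left (t : ℝ) : kern 0 t = 1 / 2 := by
  have : ¬ ((0 < t ∧ t ≤ 0) ∨ (0 ≤ t ∧ t < 0)) := by
    rintro (h | h) <;> linarith [h.1, h.2]
  simp [kern, this]

theorem kern_of_pos {p t : ℝ} (hp : 0 < p) : kern p t = 1 / 2 - if 0 < t ∧ t ≤ p then 1 else 0 := by
  have : ¬ (p ≤ t ∧ t < 0) := fun h => by linarith [h.1, h.2]
  simp [kern, this]

theorem kern_of_neg {p t : ℝ} (hp : p < 0) : kern p t = 1 / 2 - if p ≤ t ∧ t < 0 then 1 else 0 := by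
  have : ¬ (0 < t ∧ t ≤ p) := fun h => by linarith [h.1, h.2]
  simp [kern, this]

theorem integral_exp_segment (w : ℝ) (a b : ℝ) (c : ℂ) :
    -(Complex.I * w) * ∫ p in a..b, c * Complex.exp (-(Complex.I * w * p)) =
      c * (Complex.exp (-(Complex.I * w * b)) - Complex.exp (-(Complex.I * w * a))) := by
  have h : ∀ p : ℝ, HasDerivAt (fun p : ℝ => c * Complex.exp (-(Complex.I * w * p)))
      (-(Complex.I * w) * (c * Complex.exp (-(Complex.I * w * p)))) p := by
    intro p
    have h1 : HasDerivAt (fun p : ℝ => -(Complex.I * w * (p : ℂ))) (-(Complex.I * w * 1)) p :=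
      ((Complex.ofRealCLM.hasDerivAt (x := p)).const_mul (Complex.I * w)).neg
    exact (h1.cexp.const_mul c).congr_deriv (by ring)
  rw [← intervalIntegral.integral_const_mul,
    intervalIntegral.integral_eq_sub_of_hasDerivAt (fun p _ => h p)]
  · ring
  · exact Continuous.intervalIntegrable (by fun_prop) _ _

/-- Only the open interval enters, so the values of a step function at its jumps never matter. -/
theorem intervalIntegral_congr_exp {a b : ℝ} (hab : a ≤ b) {F : ℝ → ℝ} {c : ℝ} (w : ℝ)
    (h : ∀ p ∈ Set.Ioo a b, F p = c) :
    IntervalIntegrable (fun p => (F p : ℂ) * Complex.exp (-(Complex.I * w * p))) volume a b ∧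
    -(Complex.I * w) * ∫ p in a..b, (F p : ℂ) * Complex.exp (-(Complex.I * w * p)) =
      c * (Complex.exp (-(Complex.I * w * b)) - Complex.exp (-(Complex.I * w * a))) := by
  have hc : IntervalIntegrable (fun p : ℝ => (c : ℂ) * Complex.exp (-(Complex.I * w * p)))
      volume a b := Continuous.intervalIntegrable (by fun_prop) _ _
  constructor
  · rw [intervalIntegrable_iff_integrableOn_Ioo_of_le hab] at hc ⊢
    refine hc.congr_fun (fun p hp => ?_) measurableSet_Ioo
    simp only [h p hp]
  · rw [← integral_exp_segment, intervalIntegral.integral_of_le hab,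
      intervalIntegral.integral_of_le hab, integral_Ioc_eq_integral_Ioo,
      integral_Ioc_eq_integral_Ioo]
    congr 1
    refine setIntegral_congr_fun measurableSet_Ioo fun p hp => ?_
    simp only [h p hp]

/-- On `[-1, 1]` the function `p ↦ sgn p · kern p t` is a step function with values `±1/2`, jumping
by `+1` at `0` and by `-1` at `t`. Integration by parts against the exponential thus isolates the
exponential at `t`; the jump at `0` yields the constant `1 = 2 * kern 0 t`, the endpoints yield the
remaining two terms. -/
theorem exp_eq_integral_kern {t : ℝ} (ht : t ≠ 0) (h1 : -1 < t) (h2 : t < 1) (w : ℝ) :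
    Complex.exp (-(Complex.I * w * t)) =
      -(Complex.I * w) * (∫ p in (-1 : ℝ)..1, ((Real.sign p * kern p t : ℝ) : ℂ) *
          Complex.exp (-(Complex.I * w * p)))
        + 2 * kern 0 t - kern 1 t * Complex.exp (-(Complex.I * w))
        - kern (-1) t * Complex.exp (Complex.I * w) := by
  rw [kern_zero_left]
  rcases lt_or_gt_of_ne ht with ht | ht
  · have A := intervalIntegral_congr_exp h1.le (F := fun p => Real.sign p * kern p t)
      (c := 1 / 2) w (fun p hp => by
        have hp0 : p < 0 := hp.2.trans ht
        simp only [Real.sign_of_neg hp0, kern_of_neg hp0, hp.2.le, ht, and_self, if_true]; norm_num)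
    have B := intervalIntegral_congr_exp ht.le (F := fun p => Real.sign p * kern p t)
      (c := -1 / 2) w (fun p hp => by
        simp only [Real.sign_of_neg hp.2, kern_of_neg hp.2, hp.1.not_ge, false_and, if_false]
        norm_num)
    have C := intervalIntegral_congr_exp zero_le_one (F := fun p => Real.sign p * kern p t)
      (c := 1 / 2) w (fun p hp => by
        simp only [Real.sign_of_pos hp.1, kern_of_pos hp.1, ht.not_gt, false_and, if_false]
        norm_num)
    rw [← intervalIntegral.integral_add_adjacent_intervals (A.1.trans B.1) C.1,
      ← intervalIntegral.integral_add_adjacent_intervals A.1 B.1, mul_add, mul_add,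
      A.2, B.2, C.2, kern_of_pos one_pos, kern_of_neg (by norm_num)]
    simp only [ht.not_gt, false_and, if_false, h1.le, ht, and_self, if_true]
    push_cast
    simp
    ring
  · have A := intervalIntegral_congr_exp (a := -1) (b := 0) (by norm_num)
      (F := fun p => Real.sign p * kern p t)
      (c := -1 / 2) w (fun p hp => by
        simp only [Real.sign_of_neg hp.2, kern_of_neg hp.2, ht.not_gt, and_false, if_false]
        norm_num)
    have B := intervalIntegral_congr_exp ht.le (F := fun p => Real.sign p * kern p t)
      (c := 1 / 2) w (fun p hp => by
        simp only [Real.sign_of_pos hp.1, kern_of_pos hp.1, hp.2.not_ge, and_false, if_false]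
        norm_num)
    have C := intervalIntegral_congr_exp h2.le (F := fun p => Real.sign p * kern p t)
      (c := -1 / 2) w (fun p hp => by
        have hp0 : 0 < p := ht.trans hp.1
        simp only [Real.sign_of_pos hp0, kern_of_pos hp0, ht, hp.1.le, and_self, if_true]
        norm_num)
    rw [← intervalIntegral.integral_add_adjacent_intervals (A.1.trans B.1) C.1,
      ← intervalIntegral.integral_add_adjacent_intervals A.1 B.1, mul_add, mul_add,
      A.2, B.2, C.2, kern_of_pos one_pos, kern_of_neg (by norm_num)]
    simp only [ht.not_gt, and_false, if_false, h2.le, ht, and_self, if_true]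
    push_cast
    simp
    ring

end Kernel

/-! ### The disc transform as a half-plane transform of the inverted density. -/

section HalfPlane

/-- Up to a function of `φ` and the sign of `p`, the integral of `g` over the half-plane
`{y | p < y · dir φ}`. -/
noncomputable def halfPlaneTransform (g : Plane → ℝ) (p φ : ℝ) : ℝ :=
  ∫ y, g y * kern p (inner ℝ y (dir φ))

/-- The density of the image of `f dx` under the inversion. -/
noncomputable def pullback (f : Plane → ℝ) (y : Plane) : ℝ := (‖y‖ ^ 4)⁻¹ * f (circInv y)

theorem ae_inner_dir_ne_zero (φ : ℝ) : ∀ᵐ y : Plane, inner ℝ y (dir φ) ≠ 0 := by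
  have h := Measure.addHaar_submodule (volume : Measure Plane) (ℝ ∙ dir φ)ᗮ (by
    intro h
    have h1 : dir φ ∈ (ℝ ∙ dir φ)ᗮ := h ▸ Submodule.mem_top
    rw [Submodule.mem_orthogonal_singleton_iff_inner_right, real_inner_self_eq_norm_sq,
      norm_dir] at h1
    norm_num at h1)
  refine measure_mono_null (fun y hy => ?_) h
  simp only [ne_eq, Set.mem_compl_iff, Set.mem_ofPred_eq, not_not] at hy
  rw [SetLike.mem_coe, Submodule.mem_orthogonal_singleton_iff_inner_left]
  exact hy

theorem measurable_inner_dir (φ : ℝ) : Measurable fun y : Plane => inner ℝ y (dir φ) := by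
  fun_prop

theorem integrable_mul_kern {g : Plane → ℝ} (hg : Integrable g) (p φ : ℝ) :
    Integrable fun y => g y * kern p (inner ℝ y (dir φ)) := by
  refine hg.mul_bdd (c := 1 / 2) ?_ (Eventually.of_forall fun y => abs_kern_le _ _)
  exact (measurable_kern.comp (measurable_const.prodMk (measurable_inner_dir φ))).aestronglyMeasurable

theorem inner_circInv (x v : Plane) : inner ℝ (circInv x) v = (‖x‖ ^ 2)⁻¹ * inner ℝ x v := by
  rw [circInv, real_inner_smul_left]

/-- Divide `p ‖x‖² < x · dir φ` by `‖x‖²`. At the origin both sides are false because `p > 0`. -/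
theorem mem_disc_iff_circInv {p : ℝ} (hp : 0 < p) (φ : ℝ) (x : Plane) :
    x ∈ disc (1 / p) φ ↔ p < inner ℝ (circInv x) (dir φ) := by
  rw [mem_disc_iff hp, inner_circInv]
  rcases eq_or_ne x 0 with rfl | hx
  · simp [hp.le]
  · have : 0 < ‖x‖ ^ 2 := by positivity
    rw [inv_mul_eq_div, lt_div_iff₀ this]

theorem inner_pos_iff_circInv (v x : Plane) :
    0 < inner ℝ x v ↔ 0 < inner ℝ (circInv x) v := by
  rw [inner_circInv]
  rcases eq_or_ne x 0 with rfl | hx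
  · simp
  · have : 0 < (‖x‖ ^ 2)⁻¹ := by positivity
    rw [mul_pos_iff_of_pos_left this]

theorem discTransform₁_eq (f : Plane → ℝ) {p : ℝ} (hp : 0 < p) (φ : ℝ) :
    discTransform₁ f p φ = ∫ x, f x * if p < inner ℝ (circInv x) (dir φ) then 1 else 0 := by
  rw [discTransform₁, ← integral_indicator (show MeasurableSet (disc (1 / p) φ) from
    measurableSet_ball)]
  congr 1; ext x
  classical
  rw [Set.indicator_apply, mul_ite, mul_one, mul_zero]
  exact if_congr (mem_disc_iff_circInv hp φ x) rfl rfl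

theorem discTransform₁ZeroPlus_eq {f : Plane → ℝ} (hf : Integrable f) (φ : ℝ) :
    discTransform₁ZeroPlus f φ =
      ∫ x, f x * if 0 < inner ℝ (circInv x) (dir φ) then 1 else 0 := by
  rw [discTransform₁ZeroPlus, (tendsto_discTransform₁ hf φ).limUnder_eq, ← integral_indicator
    (isOpen_lt continuous_const (by fun_prop)).measurableSet]
  congr 1; ext x
  classical
  rw [Set.indicator_apply, mul_ite, mul_one, mul_zero]
  exact if_congr (inner_pos_iff_circInv (dir φ) x) rfl rfl

theorem integrable_mul_ite {f : Plane → ℝ} (hf : Integrable f) {s : Set Plane}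
    [DecidablePred (· ∈ s)] (hs : MeasurableSet s) :
    Integrable fun x => f x * if x ∈ s then 1 else 0 := by
  refine (hf.indicator hs).congr (Eventually.of_forall fun x => ?_)
  simp only [Set.indicator_apply, mul_ite, mul_one, mul_zero]

/-- With `t` the inner product after inversion, the claim is an identity of indicators for `t ≠ 0`.
For `p > 0`, for instance, `1_{p < t} + (1_{t < 0} - 1_{0 < t}) / 2 = 1/2 - 1_{0 < t ≤ p}`. -/
theorem discTransform_eq_integral {f : Plane → ℝ} (hf : Integrable f) (p φ : ℝ) :
    discTransform f p φ = ∫ x, f x * kern p (inner ℝ (circInv x) (dir φ)) := by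
  have hm : Measurable fun x => inner ℝ (circInv x) (dir φ) := by
    have := measurable_circInv
    fun_prop
  have hpos : ∀ p, Integrable fun x => f x * if p < inner ℝ (circInv x) (dir φ) then 1 else 0 :=
    fun p => integrable_mul_ite (s := {x | p < inner ℝ (circInv x) (dir φ)}) hf
      (measurableSet_lt measurable_const hm)
  have hneg : ∀ p, Integrable fun x => f x * if inner ℝ (circInv x) (dir φ) < p then 1 else 0 :=
    fun p => integrable_mul_ite (s := {x | inner ℝ (circInv x) (dir φ) < p}) hf
      (measurableSet_lt hm measurable_const)
  have hae : ∀ᵐ x : Plane, inner ℝ (circInv x) (dir φ) ≠ 0 := by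
    have h0 : ∀ᵐ x : Plane, x ≠ 0 := by simp [ae_iff]
    filter_upwards [ae_inner_dir_ne_zero φ, h0] with x hx h0
    rw [inner_circInv]
    have : ‖x‖ ≠ 0 := norm_ne_zero_iff.2 h0
    positivity
  have hd : Integrable fun x => ((f x * if inner ℝ (circInv x) (dir φ) < 0 then 1 else 0) -
      f x * if 0 < inner ℝ (circInv x) (dir φ) then 1 else 0) / 2 :=
    ((hneg 0).sub (hpos 0)).div_const 2
  have hZ := discTransform₁ZeroPlus_eq hf φ
  have hZ' : discTransform₁ZeroPlus f (φ + Real.pi) =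
      ∫ x, f x * if inner ℝ (circInv x) (dir φ) < 0 then 1 else 0 := by
    rw [discTransform₁ZeroPlus_eq hf, dir_add_pi]
    simp
  rw [discTransform, discTransform₂, jump, hZ, hZ']
  rcases lt_trichotomy p 0 with hp | rfl | hp
  · rw [if_neg hp.not_gt, if_neg hp.ne, discTransform₁_eq f (neg_pos.2 hp), dir_add_pi,
      Real.sign_of_neg hp]
    simp only [inner_neg_right, neg_lt_neg_iff]
    rw [← integral_sub (hneg 0) (hpos 0), mul_neg_one, ← sub_eq_add_neg, ← integral_div,
      ← integral_sub (hneg p) hd]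
    refine integral_congr_ae ?_
    filter_upwards [hae] with x hx
    rw [kern_of_neg hp]
    rcases lt_or_gt_of_ne hx with h | h
    · by_cases h' : inner ℝ (circInv x) (dir φ) < p
      · simp [h, h', h'.not_ge, h.not_gt]; ring
      · simp [h, h', h.not_gt, not_lt.1 h']; ring
    · simp [h, h.not_gt, (hp.trans h).not_gt]; ring
  · rw [if_neg (lt_irrefl _), if_pos rfl, Real.sign_zero, mul_zero, add_zero,
      ← integral_add (hpos 0) (hneg 0), ← integral_div]
    refine integral_congr_ae ?_
    filter_upwards [hae] with x hx
    rw [kern_zero_left]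
    rcases lt_or_gt_of_ne hx with h | h
    · simp [h, h.not_gt]; ring
    · simp [h, h.not_gt]; ring
  · rw [if_pos hp, discTransform₁_eq f hp, Real.sign_of_pos hp, mul_one,
      ← integral_sub (hneg 0) (hpos 0), ← integral_div,
      ← integral_add (hpos p) hd]
    refine integral_congr_ae ?_
    filter_upwards [hae] with x hx
    rw [kern_of_pos hp]
    rcases lt_or_gt_of_ne hx with h | h
    · simp [h, h.not_gt, (h.trans hp).not_gt]; ring
    · by_cases h' : p < inner ℝ (circInv x) (dir φ)
      · simp [h, h', h.not_gt, h'.not_ge]; ring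
      · simp [h, h', h.not_gt, not_lt.1 h']; ring

theorem discTransform_eq_halfPlaneTransform {f : Plane → ℝ} (hf : Integrable f) (p φ : ℝ) :
    discTransform f p φ = halfPlaneTransform (pullback f) p φ := by
  rw [discTransform_eq_integral hf, integral_circInv, halfPlaneTransform]
  simp only [circInv_circInv, pullback, smul_eq_mul, mul_assoc]

end HalfPlane

/-! ### Position of the inverted detector disc relative to the origin. -/

section Support

/-- The image of `detectorDisc r` under the inversion. -/
def invDisc (r : ℝ) : Set Plane := {y | 1 + r * ‖y‖ ^ 2 < (r + 1) * y 1}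

theorem norm_sq_plane (y : Plane) : ‖y‖ ^ 2 = y 0 ^ 2 + y 1 ^ 2 := by
  simp [EuclideanSpace.norm_sq_eq, Fin.sum_univ_two]

theorem mem_detectorDisc_iff (r : ℝ) (x : Plane) :
    x ∈ detectorDisc r ↔ ‖x‖ ^ 2 + r < (r + 1) * x 1 := by
  rw [norm_sq_plane, detectorDisc, Set.mem_ofPred_eq]
  constructor <;> intro h <;> nlinarith

theorem circInv_mem_invDisc_iff {r : ℝ} (hr : 0 < r) (x : Plane) :
    circInv x ∈ invDisc r ↔ x ∈ detectorDisc r := by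
  rw [mem_detectorDisc_iff, invDisc, Set.mem_ofPred_eq, norm_circInv]
  rcases eq_or_ne x 0 with rfl | hx
  · have h : circInv 0 = 0 := by simp [circInv]
    simp only [h, norm_zero, PiLp.zero_apply]
    constructor <;> intro h <;> norm_num at h
    linarith
  · have h : 0 < ‖x‖ := norm_pos_iff.2 hx
    simp only [circInv, PiLp.smul_apply, smul_eq_mul]
    rw [inv_pow, ← div_eq_mul_inv, inv_mul_eq_div, ← sub_pos, ← sub_pos (b := ‖x‖ ^ 2 + r)]
    have e : (r + 1) * (x 1 / ‖x‖ ^ 2) - (1 + r / ‖x‖ ^ 2) =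
        ((r + 1) * x 1 - (‖x‖ ^ 2 + r)) / ‖x‖ ^ 2 := by field_simp
    rw [e]
    exact div_pos_iff_of_pos_right (by positivity)

variable {r : ℝ} {y : Plane}

/-- Since `y 1 ≤ ‖y‖`, the defining inequality gives `(r ‖y‖ - 1) (‖y‖ - 1) < 0`. -/
theorem norm_bounds_of_mem_invDisc (hr : 1 < r) (hy : y ∈ invDisc r) : r⁻¹ < ‖y‖ ∧ ‖y‖ < 1 := by
  have h1 : y 1 ≤ ‖y‖ := (le_abs_self _).trans (PiLp.norm_apply_le y 1)
  have hy' : 1 + r * ‖y‖ ^ 2 < (r + 1) * y 1 := hy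
  have h2 : (r * ‖y‖ - 1) * (‖y‖ - 1) < 0 := by nlinarith
  have h3 : ‖y‖ < 1 := by
    by_contra! h
    have : 0 ≤ (r * ‖y‖ - 1) * (‖y‖ - 1) := mul_nonneg (by nlinarith) (by linarith)
    linarith
  refine ⟨?_, h3⟩
  rw [inv_lt_iff_one_lt_mul₀ (by linarith)]
  by_contra! h
  have : 0 ≤ (r * ‖y‖ - 1) * (‖y‖ - 1) := mul_nonneg_of_nonpos_of_nonpos (by linarith) (by linarith)
  linarith

theorem abs_inner_dir_le (y : Plane) (φ : ℝ) : |inner ℝ y (dir φ)| ≤ ‖y‖ := by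
  simpa [norm_dir] using abs_real_inner_le_norm y (dir φ)

theorem snd_pos_of_mem_invDisc (hr : 1 < r) (hy : y ∈ invDisc r) : 1 < (r + 1) * y 1 := by
  have hy' : 1 + r * ‖y‖ ^ 2 < (r + 1) * y 1 := hy
  have : 0 ≤ r * ‖y‖ ^ 2 := by positivity
  linarith

/-- The disc is centred on the vertical axis and has radius `(r - 1) / (2 r) < 1/2`. -/
theorem abs_fst_le_of_mem_invDisc (hr : 1 < r) (hy : y ∈ invDisc r) : |y 0| ≤ 1 / 2 := by
  have hy' : 1 + r * ‖y‖ ^ 2 < (r + 1) * y 1 := hy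
  rw [norm_sq_plane] at hy'
  by_contra! h
  have h2 : 1 / 4 < y 0 ^ 2 := by
    rw [← sq_abs]; nlinarith
  have h3 : 1 + r * (1 / 4 + y 1 ^ 2) < (r + 1) * y 1 := by nlinarith
  have h4 := mul_lt_mul_of_pos_left h3 (show 0 < 4 * r by linarith)
  nlinarith [sq_nonneg (2 * r * y 1 - (r + 1))]

theorem neg_half_le_inner_dir (hr : 1 < r) (hy : y ∈ invDisc r) {φ : ℝ} (hφ : 0 ≤ Real.sin φ) :
    -1 / 2 ≤ inner ℝ y (dir φ) := by
  have h1 := abs_fst_le_of_mem_invDisc hr hy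
  have h2 := snd_pos_of_mem_invDisc hr hy
  have h3 : 0 ≤ y 1 := by
    by_contra! h; nlinarith
  rw [inner_dir]
  have h4 : |y 0 * Real.cos φ| ≤ 1 / 2 * 1 := by
    rw [abs_mul]; exact mul_le_mul h1 (Real.abs_cos_le_one φ) (abs_nonneg _) (by norm_num)
  have h5 := neg_le_of_abs_le h4
  have : 0 ≤ y 1 * Real.sin φ := mul_nonneg h3 hφ
  linarith

/-- Here `|y 0| ≤ 1/2` and `y 1 > 1 / (r + 1)`, so the vertical contribution outweighs the
horizontal one once `sin φ / (r + 1)` exceeds `|cos φ| / 2`. -/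
theorem inner_dir_nonneg (hr : 1 < r) (hy : y ∈ invDisc r) {φ : ℝ}
    (hφ : |Real.cos φ| * (r + 1) < 2 * Real.sin φ) : 0 ≤ inner ℝ y (dir φ) := by
  have h1 := abs_fst_le_of_mem_invDisc hr hy
  have h2 := snd_pos_of_mem_invDisc hr hy
  rw [inner_dir]
  have h4 : |y 0 * Real.cos φ| ≤ 1 / 2 * |Real.cos φ| := by
    rw [abs_mul]; exact mul_le_mul_of_nonneg_right h1 (abs_nonneg _)
  have h5 := neg_le_of_abs_le h4
  have h6 : 0 ≤ |Real.cos φ| := abs_nonneg _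
  have h7 : 0 < Real.sin φ := by nlinarith
  have h8 : Real.sin φ ≤ (r + 1) * y 1 * Real.sin φ := le_mul_of_one_le_left h7.le h2.le
  have h9 : 1 / 2 * |Real.cos φ| * (r + 1) ≤ y 1 * Real.sin φ * (r + 1) := by nlinarith
  have := le_of_mul_le_mul_right h9 (by linarith)
  linarith

end Support

/-! ### Stability in `H^{-3/2}` for the half-plane transform. -/

section HalfPlaneEstimates

variable {r : ℝ} {g : Plane → ℝ}

theorem halfPlaneTransform_congr (hs : ∀ y, g y ≠ 0 → y ∈ invDisc r) {p p' φ : ℝ}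
    (h : ∀ y ∈ invDisc r, kern p (inner ℝ y (dir φ)) = kern p' (inner ℝ y (dir φ))) :
    halfPlaneTransform g p φ = halfPlaneTransform g p' φ := by
  refine integral_congr_ae (Eventually.of_forall fun y => ?_)
  by_cases hy : g y = 0
  · simp [hy]
  · simp only [h y (hs y hy)]

theorem halfPlaneTransform_zero (g : Plane → ℝ) (φ : ℝ) :
    halfPlaneTransform g 0 φ = (∫ y, g y) / 2 := by
  simp only [halfPlaneTransform, kern_zero_left]
  rw [integral_mul_const]; ring

/-- On the support `|t| < 1`, so the kernels at `p = 1` and `p = -1` are `1/2 - 1_{t > 0}` and `1/2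
- 1_{t < 0}`, which cancel off `t = 0`. -/
theorem halfPlaneTransform_neg_one (hr : 1 < r) (hs : ∀ y, g y ≠ 0 → y ∈ invDisc r) (φ : ℝ) :
    halfPlaneTransform g (-1) φ = -halfPlaneTransform g 1 φ := by
  rw [halfPlaneTransform, halfPlaneTransform, ← integral_neg]
  refine integral_congr_ae ?_
  filter_upwards [ae_inner_dir_ne_zero φ] with y hy0
  by_cases hy : g y = 0
  · simp [hy]
  have h1 := (abs_inner_dir_le y φ).trans_lt (norm_bounds_of_mem_invDisc hr (hs y hy)).2
  rw [abs_lt] at h1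
  rw [kern_of_pos one_pos, kern_of_neg (by norm_num)]
  rcases lt_or_gt_of_ne hy0 with h | h
  · simp [h, h.not_gt, h1.1.le]; ring
  · simp [h, h.not_gt, h1.2.le]; ring

/-- This turns the boundary value, which is not controlled by an `L²` norm in general, into part of
the data. The support projects into `t ≥ -1/2` or into `t ≤ 1/2`, according to the sign of `sin φ`;
on the `p`-interval of length `1/2` beyond it the transform is constant. The factor `2` is the
reciprocal of that length. -/
theorem enorm_halfPlaneTransform_one_sq_le (hr : 1 < r) (hs : ∀ y, g y ≠ 0 → y ∈ invDisc r)
    (φ : ℝ) : ‖halfPlaneTransform g 1 φ‖ₑ ^ 2 ≤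
      2 * ∫⁻ p in Set.Icc (-1 : ℝ) 1, ‖halfPlaneTransform g p φ‖ₑ ^ 2 := by
  have key : ∀ a b : ℝ, b - a = 1 / 2 → Set.Icc a b ⊆ Set.Icc (-1 : ℝ) 1 →
      (∀ p ∈ Set.Icc a b, ‖halfPlaneTransform g p φ‖ₑ = ‖halfPlaneTransform g 1 φ‖ₑ) →
      ‖halfPlaneTransform g 1 φ‖ₑ ^ 2 ≤
        2 * ∫⁻ p in Set.Icc (-1 : ℝ) 1, ‖halfPlaneTransform g p φ‖ₑ ^ 2 := by
    intro a b hab hsub h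
    calc ‖halfPlaneTransform g 1 φ‖ₑ ^ 2
        = 2 * ∫⁻ p in Set.Icc a b, ‖halfPlaneTransform g p φ‖ₑ ^ 2 := by
          rw [setLIntegral_congr_fun (g := fun _ => ‖halfPlaneTransform g 1 φ‖ₑ ^ 2)
            measurableSet_Icc (fun p hp => by simp only [h p hp]), setLIntegral_const,
            Real.volume_Icc, hab, mul_comm _ (ENNReal.ofReal _), ← mul_assoc,
            ← ENNReal.ofReal_ofNat, ← ENNReal.ofReal_mul (by norm_num)]
          norm_num
      _ ≤ _ := by gcongr
  rcases le_total 0 (Real.sin φ) with h | h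
  · refine key (-1) (-1 / 2) (by norm_num) (Set.Icc_subset_Icc le_rfl (by norm_num)) fun p hp => ?_
    rw [← enorm_neg (halfPlaneTransform g 1 φ), ← halfPlaneTransform_neg_one hr hs]
    congr 1
    refine halfPlaneTransform_congr hs fun y hy => ?_
    have h1 := neg_half_le_inner_dir hr hy h
    rw [kern_of_neg (by linarith [hp.2]), kern_of_neg (by norm_num)]
    have h2 := hp.2.trans h1
    have h3 : -1 ≤ inner ℝ y (dir φ) := by linarith
    simp only [h2, h3, true_and]
  · refine key (1 / 2) 1 (by norm_num) (Set.Icc_subset_Icc (by norm_num) le_rfl) fun p hp => ?_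
    congr 1
    refine halfPlaneTransform_congr hs fun y hy => ?_
    have h1 := neg_half_le_inner_dir hr hy (φ := φ + Real.pi) (by rw [Real.sin_add_pi]; linarith)
    rw [dir_add_pi, inner_neg_right] at h1
    rw [kern_of_pos (by linarith [hp.1]), kern_of_pos (by norm_num)]
    have h2 : inner ℝ y (dir φ) ≤ p := by linarith [hp.1]
    have h3 : inner ℝ y (dir φ) ≤ 1 := by linarith
    simp only [h2, h3, and_true]

/-- The angles of the lines through the origin that do not meet `invDisc r`, with `dir φ` pointing
to the side of the disc. -/
def freeAngles (r : ℝ) : Set ℝ :=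
  {φ | |Real.cos φ| * (r + 1) < 2 * Real.sin φ} ∩ Set.Ioo 0 (2 * Real.pi)

theorem isOpen_freeAngles (r : ℝ) : IsOpen (freeAngles r) :=
  (isOpen_lt (by fun_prop) (by fun_prop)).inter isOpen_Ioo

theorem volume_freeAngles_ne_zero (r : ℝ) : volume (freeAngles r) ≠ 0 := by
  refine ((isOpen_freeAngles r).measure_pos volume ⟨Real.pi / 2, ?_, ?_⟩).ne'
  · simp
  · constructor <;> linarith [Real.pi_pos]

theorem volume_freeAngles_ne_top (r : ℝ) : volume (freeAngles r) ≠ ⊤ :=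
  ((measure_mono Set.inter_subset_right).trans_lt measure_Ioo_lt_top).ne

/-- For a free angle the support lies in `t ≥ 0`, so the strips with `p ≤ 0` miss it and the
transform equals half the total mass for all `p ∈ [-1, 0]`. Averaging over the free angles, a set of
positive measure, recovers the mass; halving it accounts for the factor `4`. -/
theorem enorm_integral_sq_le (hr : 1 < r) (hs : ∀ y, g y ≠ 0 → y ∈ invDisc r) :
    ‖∫ y, g y‖ₑ ^ 2 ≤ 4 * (volume (freeAngles r))⁻¹ *
      ∫⁻ φ in Set.Ioo 0 (2 * Real.pi), ∫⁻ p in Set.Icc (-1 : ℝ) 1,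
        ‖halfPlaneTransform g p φ‖ₑ ^ 2 := by
  have h1 : ∀ φ ∈ freeAngles r, ∀ p ∈ Set.Icc (-1 : ℝ) 0,
      ‖halfPlaneTransform g p φ‖ₑ ^ 2 = ‖(∫ y, g y) / 2‖ₑ ^ 2 := by
    intro φ hφ p hp
    rw [← halfPlaneTransform_zero g φ]
    congr 2
    refine halfPlaneTransform_congr hs fun y hy => ?_
    have h1 := inner_dir_nonneg hr hy hφ.1
    rw [kern_zero_left]
    have : ¬ ((0 < inner ℝ y (dir φ) ∧ inner ℝ y (dir φ) ≤ p) ∨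
        (p ≤ inner ℝ y (dir φ) ∧ inner ℝ y (dir φ) < 0)) := by
      rintro (h | h)
      · linarith [h.1, h.2, hp.2]
      · linarith [h.2]
    simp [kern, this]
  have h2 : volume (freeAngles r) * ‖(∫ y, g y) / 2‖ₑ ^ 2 ≤
      ∫⁻ φ in Set.Ioo 0 (2 * Real.pi), ∫⁻ p in Set.Icc (-1 : ℝ) 1,
        ‖halfPlaneTransform g p φ‖ₑ ^ 2 := by
    calc volume (freeAngles r) * ‖(∫ y, g y) / 2‖ₑ ^ 2
        = ∫⁻ φ in freeAngles r, ∫⁻ p in Set.Icc (-1 : ℝ) 0, ‖(∫ y, g y) / 2‖ₑ ^ 2 := by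
          simp [mul_comm]
      _ = ∫⁻ φ in freeAngles r, ∫⁻ p in Set.Icc (-1 : ℝ) 0, ‖halfPlaneTransform g p φ‖ₑ ^ 2 := by
          refine setLIntegral_congr_fun (isOpen_freeAngles r).measurableSet fun φ hφ => ?_
          exact setLIntegral_congr_fun measurableSet_Icc fun p hp => (h1 φ hφ p hp).symm
      _ ≤ ∫⁻ φ in freeAngles r, ∫⁻ p in Set.Icc (-1 : ℝ) 1, ‖halfPlaneTransform g p φ‖ₑ ^ 2 :=
          lintegral_mono fun φ => lintegral_mono_set (Set.Icc_subset_Icc le_rfl zero_le_one)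
      _ ≤ _ := lintegral_mono_set Set.inter_subset_right
  have h3 : ‖∫ y, g y‖ₑ ^ 2 = 4 * ‖(∫ y, g y) / 2‖ₑ ^ 2 := by
    conv_lhs => rw [show ∫ y, g y = 2 * ((∫ y, g y) / 2) by ring]
    rw [enorm_mul, mul_pow]
    congr 1
    rw [Real.enorm_eq_ofReal (by norm_num)]
    norm_num
  rw [h3, mul_assoc]
  refine mul_le_mul_right ?_ 4
  calc ‖(∫ y, g y) / 2‖ₑ ^ 2
      = (volume (freeAngles r))⁻¹ * (volume (freeAngles r) * ‖(∫ y, g y) / 2‖ₑ ^ 2) := by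
        rw [← mul_assoc, ENNReal.inv_mul_cancel (volume_freeAngles_ne_zero r)
          (volume_freeAngles_ne_top r), one_mul]
    _ ≤ _ := mul_le_mul_right h2 _

theorem measurable_halfPlaneTransform (hm : Measurable g) :
    Measurable fun z : ℝ × ℝ => halfPlaneTransform g z.1 z.2 := by
  have h : StronglyMeasurable fun w : (ℝ × ℝ) × Plane =>
      g w.2 * kern w.1.1 (inner ℝ w.2 (dir w.1.2)) := by
    refine Measurable.stronglyMeasurable ?_
    refine (hm.comp measurable_snd).mul (measurable_kern.comp (Measurable.prodMk (by fun_prop) ?_))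
    have := continuous_dir.measurable
    fun_prop
  exact h.integral_prod_right.measurable

theorem abs_halfPlaneTransform_le (hg : Integrable g) (p φ : ℝ) :
    |halfPlaneTransform g p φ| ≤ ∫ y, |g y| := by
  refine (norm_integral_le_integral_norm _).trans (integral_mono (integrable_mul_kern hg p φ).norm
    hg.norm fun y => ?_)
  simp only [norm_mul, Real.norm_eq_abs]
  have := abs_kern_le p (inner ℝ y (dir φ))
  exact mul_le_of_le_one_right (abs_nonneg _) (by linarith)

open FourierTransform

/-- The odd reflection of the transform, cut off to `[-1, 1]`. -/
noncomputable def oddPart (g : Plane → ℝ) (φ : ℝ) : ℝ → ℂ :=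
  (Set.Ioc (-1 : ℝ) 1).indicator fun p => ((Real.sign p * halfPlaneTransform g p φ : ℝ) : ℂ)

theorem measurable_sign : Measurable Real.sign := by
  unfold Real.sign
  exact Measurable.ite measurableSet_Iio measurable_const
    (Measurable.ite measurableSet_Ioi measurable_const measurable_const)

theorem abs_sign_le (p : ℝ) : |Real.sign p| ≤ 1 := by
  rcases Real.sign_apply_eq p with h | h | h <;> simp [h]

theorem measurable_oddPart (hm : Measurable g) (φ : ℝ) : Measurable (oddPart g φ) := by
  have h : Measurable fun p => halfPlaneTransform g p φ :=
    Measurable.of_uncurry_right (f := halfPlaneTransform g) (measurable_halfPlaneTransform hm)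
  refine Measurable.indicator ?_ measurableSet_Ioc
  exact Complex.measurable_ofReal.comp (measurable_sign.mul h)

theorem norm_oddPart_le (g : Plane → ℝ) (φ p : ℝ) : ‖oddPart g φ p‖ ≤
    (Set.Ioc (-1 : ℝ) 1).indicator (fun p => |halfPlaneTransform g p φ|) p := by
  unfold oddPart
  by_cases hp : p ∈ Set.Ioc (-1 : ℝ) 1
  · simp only [Set.indicator_of_mem hp, Complex.norm_real, Real.norm_eq_abs, abs_mul]
    exact mul_le_of_le_one_left (abs_nonneg _) (abs_sign_le p)
  · simp [Set.indicator_of_notMem hp]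

theorem memLp_oddPart (hg : Integrable g) (hm : Measurable g) (φ : ℝ) (q : ℝ≥0∞) :
    MemLp (oddPart g φ) q := by
  have h : MemLp ((Set.Ioc (-1 : ℝ) 1).indicator fun _ => ∫ y, |g y|) q (volume : Measure ℝ) :=
    memLp_indicator_const q measurableSet_Ioc _ (.inr (by simp))
  refine h.mono (measurable_oddPart hm φ).aestronglyMeasurable (Eventually.of_forall fun p => ?_)
  refine (norm_oddPart_le g φ p).trans ((le_abs_self _).trans' ?_)
  exact Set.indicator_le_indicator (abs_halfPlaneTransform_le hg p φ)

theorem lintegral_enorm_fourier_oddPart_le (hg : Integrable g) (hm : Measurable g) (φ : ℝ) :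
    ∫⁻ s, ‖𝓕 (oddPart g φ) s‖ₑ ^ 2 ≤
      ∫⁻ p in Set.Icc (-1 : ℝ) 1, ‖halfPlaneTransform g p φ‖ₑ ^ 2 := by
  rw [lintegral_enorm_fourier_sq (memLp_one_iff_integrable.1 (memLp_oddPart hg hm φ 1))
    (memLp_oddPart hg hm φ 2), ← lintegral_indicator measurableSet_Icc]
  refine lintegral_mono fun p => ?_
  have h := norm_oddPart_le g φ p
  by_cases hp : p ∈ Set.Ioc (-1 : ℝ) 1
  · rw [Set.indicator_of_mem hp] at h
    rw [Set.indicator_of_mem (Set.Ioc_subset_Icc_self hp)]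
    gcongr
    rw [← ofReal_norm, ← ofReal_norm]
    exact ENNReal.ofReal_le_ofReal h
  · rw [oddPart, Set.indicator_of_notMem hp]
    simp

/-- A Fourier slice theorem after integration by parts: multiply `exp_eq_integral_kern` at `t = y ·
dir φ` by `g y`, integrate in `y`, and exchange the integrals by Fubini. -/
theorem fourier_smul_dir (hr : 1 < r) (hg : Integrable g) (hm : Measurable g)
    (hs : ∀ y, g y ≠ 0 → y ∈ invDisc r) (s φ : ℝ) :
    𝓕 (fun y => (g y : ℂ)) (s • dir φ) =
      -(Complex.I * (2 * Real.pi * s : ℝ)) * 𝓕 (oddPart g φ) s + (∫ y, g y : ℝ)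
      - halfPlaneTransform g 1 φ * Complex.exp (-(Complex.I * (2 * Real.pi * s : ℝ)))
      - halfPlaneTransform g (-1) φ * Complex.exp (Complex.I * (2 * Real.pi * s : ℝ)) := by
  set w : ℝ := 2 * Real.pi * s with hw
  set t : Plane → ℝ := fun y => inner ℝ y (dir φ) with ht
  have htm : Measurable t := measurable_inner_dir φ
  set G : Plane → ℝ → ℂ := fun y p =>
    ((g y * (Real.sign p * kern p (t y)) : ℝ) : ℂ) * Complex.exp (-(Complex.I * w * p)) with hG
  have hexp : ∀ p : ℝ, ‖Complex.exp (-(Complex.I * w * p))‖ = 1 := by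
    intro p
    rw [show -(Complex.I * w * p) = ((-(w * p) : ℝ) : ℂ) * Complex.I by push_cast; ring]
    exact Complex.norm_exp_ofReal_mul_I _
  have hGi : Integrable (Function.uncurry G)
      ((volume : Measure Plane).prod (volume.restrict (Set.Ioc (-1 : ℝ) 1))) := by
    have h1 : Integrable (fun z : Plane × ℝ => g z.1 * 1)
        ((volume : Measure Plane).prod (volume.restrict (Set.Ioc (-1 : ℝ) 1))) :=
      hg.mul_prod (integrable_const (1 : ℝ))
    refine h1.mono (Measurable.aestronglyMeasurable ?_) (Eventually.of_forall fun z => ?_)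
    · have h2 : Measurable fun z : Plane × ℝ => kern z.2 (t z.1) :=
        measurable_kern.comp (measurable_snd.prodMk (htm.comp measurable_fst))
      have h3 := measurable_sign
      simp only [hG, Function.uncurry_def]
      fun_prop
    · simp only [hG, Function.uncurry_def, norm_mul, hexp, Complex.norm_real, Real.norm_eq_abs,
        mul_one]
      refine mul_le_of_le_one_right (abs_nonneg _) ?_
      have := mul_le_mul (abs_sign_le z.2) (abs_kern_le z.2 (t z.1)) (abs_nonneg _) zero_le_one
      linarith
  have hk : ∀ p, Integrable fun y => ((g y * kern p (t y) : ℝ) : ℂ) := fun p =>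
    (integrable_mul_kern hg p φ).ofReal
  have e1 : 𝓕 (fun y => (g y : ℂ)) (s • dir φ) =
      ∫ y, (-(Complex.I * w) * (∫ p in Set.Ioc (-1 : ℝ) 1, G y p) + (g y : ℂ)
        - ((g y * kern 1 (t y) : ℝ) : ℂ) * Complex.exp (-(Complex.I * w))
        - ((g y * kern (-1) (t y) : ℝ) : ℂ) * Complex.exp (Complex.I * w)) := by
    rw [Real.fourier_eq']
    refine integral_congr_ae ?_
    filter_upwards [ae_inner_dir_ne_zero φ] with y hy0
    by_cases hy : g y = 0
    · simp [hG, hy]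
    have h1 := (abs_inner_dir_le y φ).trans_lt (norm_bounds_of_mem_invDisc hr (hs y hy)).2
    rw [abs_lt] at h1
    have h2 := exp_eq_integral_kern hy0 h1.1 h1.2 w
    rw [kern_zero_left, intervalIntegral.integral_of_le (by norm_num)] at h2
    have h3 : ∫ p in Set.Ioc (-1 : ℝ) 1, G y p = (g y : ℂ) * ∫ p in Set.Ioc (-1 : ℝ) 1,
        ((Real.sign p * kern p (t y) : ℝ) : ℂ) * Complex.exp (-(Complex.I * w * p)) := by
      rw [← integral_const_mul]
      congr 1; ext p
      simp only [hG]; push_cast; ring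
    have h4 : ((-2 * Real.pi * inner ℝ y (s • dir φ) : ℝ) : ℂ) * Complex.I =
        -(Complex.I * w * (t y : ℝ)) := by
      rw [real_inner_smul_right, hw]; push_cast; ring
    rw [h3, h4]
    rw [smul_eq_mul, h2]
    push_cast
    ring
  have e2 : ∫ y, ∫ p in Set.Ioc (-1 : ℝ) 1, G y p = 𝓕 (oddPart g φ) s := by
    rw [integral_integral_swap hGi, Real.fourier_real_eq_integral_exp_smul,
      ← integral_indicator measurableSet_Ioc]
    congr 1; ext p
    unfold oddPart
    by_cases hp : p ∈ Set.Ioc (-1 : ℝ) 1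
    · rw [Set.indicator_of_mem hp, Set.indicator_of_mem hp]
      simp only [hG]
      rw [integral_mul_const, integral_complex_ofReal, smul_eq_mul, mul_comm]
      congr 2
      · rw [hw]; push_cast; ring
      · rw [halfPlaneTransform, ← integral_const_mul]
        congr 1; ext y; ring
    · rw [Set.indicator_of_notMem hp, Set.indicator_of_notMem hp, smul_zero]
  rw [e1, integral_sub, integral_sub, integral_add, integral_const_mul, e2, integral_mul_const,
    integral_mul_const, integral_complex_ofReal, integral_complex_ofReal, integral_complex_ofReal]
  · rfl
  · exact hGi.integral_prod_left.const_mul _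
  · exact hg.ofReal
  · exact (hGi.integral_prod_left.const_mul _).add hg.ofReal
  · exact (hk 1).mul_const _
  · exact ((hGi.integral_prod_left.const_mul _).add hg.ofReal).sub ((hk 1).mul_const _)
  · exact (hk (-1)).mul_const _

theorem norm_fourier_smul_dir_sq_le (hr : 1 < r) (hg : Integrable g) (hm : Measurable g)
    (hs : ∀ y, g y ≠ 0 → y ∈ invDisc r) (s φ : ℝ) :
    ‖𝓕 (fun y => (g y : ℂ)) (s • dir φ)‖ ^ 2 ≤
      8 * Real.pi ^ 2 * s ^ 2 * ‖𝓕 (oddPart g φ) s‖ ^ 2 +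
        (4 * |∫ y, g y| ^ 2 + 16 * |halfPlaneTransform g 1 φ| ^ 2) := by
  have h1 : ‖Complex.exp (-(Complex.I * (2 * Real.pi * s : ℝ)))‖ = 1 := by
    rw [show -(Complex.I * (2 * Real.pi * s : ℝ)) = ((-(2 * Real.pi * s) : ℝ) : ℂ) * Complex.I by
      push_cast; ring]
    exact Complex.norm_exp_ofReal_mul_I _
  have h2 : ‖Complex.exp (Complex.I * (2 * Real.pi * s : ℝ))‖ = 1 := by
    rw [mul_comm]
    exact Complex.norm_exp_ofReal_mul_I _
  rw [fourier_smul_dir hr hg hm hs]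
  have hb : ∀ a b c d : ℂ, ‖a + b - c - d‖ ≤ ‖a‖ + ‖b‖ + ‖c‖ + ‖d‖ := fun a b c d => by
    refine (norm_sub_le _ _).trans ?_
    gcongr
    refine (norm_sub_le _ _).trans ?_
    gcongr
    exact norm_add_le _ _
  have h3 := hb (-(Complex.I * (2 * Real.pi * s : ℝ)) * 𝓕 (oddPart g φ) s) (∫ y, g y : ℝ)
      (halfPlaneTransform g 1 φ * Complex.exp (-(Complex.I * (2 * Real.pi * s : ℝ))))
      (halfPlaneTransform g (-1) φ * Complex.exp (Complex.I * (2 * Real.pi * s : ℝ)))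
  rw [norm_mul, norm_mul, norm_mul, h1, h2, halfPlaneTransform_neg_one hr hs] at h3
  simp only [norm_neg, norm_mul Complex.I, Complex.norm_I, one_mul, mul_one, Complex.norm_real,
    Real.norm_eq_abs] at h3
  rw [halfPlaneTransform_neg_one hr hs]
  refine (pow_le_pow_left₀ (norm_nonneg _) h3 2).trans ?_
  have e : 8 * Real.pi ^ 2 * s ^ 2 * ‖𝓕 (oddPart g φ) s‖ ^ 2 =
      2 * (|2 * Real.pi * s| * ‖𝓕 (oddPart g φ) s‖) ^ 2 := by
    rw [mul_pow, sq_abs]; ring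
  rw [e]
  set A := |2 * Real.pi * s| * ‖𝓕 (oddPart g φ) s‖
  set B := |∫ y, g y|
  set C := |halfPlaneTransform g 1 φ|
  -- `(A + B + 2C)² ≤ 2A² + 2(B + 2C)² ≤ 2A² + 4B² + 16C²`; the two boundary terms have equal
  -- modulus, hence `2C`.
  nlinarith [sq_nonneg (A - B - 2 * C), sq_nonneg (B - 2 * C)]

theorem lintegral_radial_fourier_le (hr : 1 < r) (hg : Integrable g) (hm : Measurable g)
    (hs : ∀ y, g y ≠ 0 → y ∈ invDisc r) (φ : ℝ) :
    ∫⁻ s in Set.Ioi (0 : ℝ), ENNReal.ofReal s *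
        (ENNReal.ofReal ((1 + ‖s • dir φ‖ ^ 2) ^ (-(3 / 2) : ℝ)) *
          ‖𝓕 (fun y => (g y : ℂ)) (s • dir φ)‖ₑ ^ 2) ≤
      ENNReal.ofReal (8 * Real.pi ^ 2 + 32 * Real.pi) *
        (∫⁻ p in Set.Icc (-1 : ℝ) 1, ‖halfPlaneTransform g p φ‖ₑ ^ 2) +
      ENNReal.ofReal (4 * Real.pi) * ‖∫ y, g y‖ₑ ^ 2 := by
  set K : ℝ := 4 * |∫ y, g y| ^ 2 + 16 * |halfPlaneTransform g 1 φ| ^ 2 with hK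
  have hK0 : 0 ≤ K := by positivity
  have hsq : ∀ x : ℂ, ‖x‖ₑ ^ 2 = ENNReal.ofReal (‖x‖ ^ 2) := fun x => by
    rw [← ofReal_norm, ENNReal.ofReal_pow (norm_nonneg _)]
  have hsq' : ∀ x : ℝ, ‖x‖ₑ ^ 2 = ENNReal.ofReal (|x| ^ 2) := fun x => by
    rw [← ofReal_norm, Real.norm_eq_abs, ENNReal.ofReal_pow (abs_nonneg _)]
  have hpt : ∀ s ∈ Set.Ioi (0 : ℝ), ENNReal.ofReal s *
        (ENNReal.ofReal ((1 + ‖s • dir φ‖ ^ 2) ^ (-(3 / 2) : ℝ)) *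
          ‖𝓕 (fun y => (g y : ℂ)) (s • dir φ)‖ₑ ^ 2) ≤
      ENNReal.ofReal (8 * Real.pi ^ 2) * ‖𝓕 (oddPart g φ) s‖ₑ ^ 2 +
        ENNReal.ofReal K * ENNReal.ofReal ((1 + s ^ 2)⁻¹) := by
    intro s hs0
    have hs0 : 0 < s := hs0
    have hq : 0 < 1 + s ^ 2 := by positivity
    rw [hsq, hsq, ← ENNReal.ofReal_mul (by positivity), ← ENNReal.ofReal_mul (by positivity),
      ← ENNReal.ofReal_mul (by positivity), ← ENNReal.ofReal_mul hK0,
      ← ENNReal.ofReal_add (by positivity) (by positivity)]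
    refine ENNReal.ofReal_le_ofReal ?_
    rw [norm_smul, norm_dir, mul_one, Real.norm_eq_abs, sq_abs]
    -- The polar Jacobian `s` absorbs half a power of `1 + s²`. What remains just offsets the factor
    -- `s²` of the data term and is integrable against the constant `K`.
    have h1 : s * (1 + s ^ 2) ^ (-(3 / 2) : ℝ) ≤ (1 + s ^ 2)⁻¹ := by
      have h2 : s ≤ (1 + s ^ 2) ^ (1 / 2 : ℝ) := by
        rw [← Real.sqrt_eq_rpow]
        exact Real.le_sqrt_of_sq_le (by linarith)
      calc s * (1 + s ^ 2) ^ (-(3 / 2) : ℝ)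
          ≤ (1 + s ^ 2) ^ (1 / 2 : ℝ) * (1 + s ^ 2) ^ (-(3 / 2) : ℝ) := by gcongr
        _ = (1 + s ^ 2)⁻¹ := by
          rw [← Real.rpow_add hq, ← Real.rpow_neg_one]; norm_num
    have h3 := norm_fourier_smul_dir_sq_le hr hg hm hs s φ
    rw [← hK] at h3
    calc s * ((1 + s ^ 2) ^ (-(3 / 2) : ℝ) * ‖𝓕 (fun y => (g y : ℂ)) (s • dir φ)‖ ^ 2)
        = (s * (1 + s ^ 2) ^ (-(3 / 2) : ℝ)) * ‖𝓕 (fun y => (g y : ℂ)) (s • dir φ)‖ ^ 2 := by ring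
      _ ≤ (1 + s ^ 2)⁻¹ * (8 * Real.pi ^ 2 * s ^ 2 * ‖𝓕 (oddPart g φ) s‖ ^ 2 + K) := by
          gcongr
      _ = 8 * Real.pi ^ 2 * ‖𝓕 (oddPart g φ) s‖ ^ 2 * (s ^ 2 * (1 + s ^ 2)⁻¹) +
          K * (1 + s ^ 2)⁻¹ := by ring
      _ ≤ 8 * Real.pi ^ 2 * ‖𝓕 (oddPart g φ) s‖ ^ 2 * 1 + K * (1 + s ^ 2)⁻¹ := by
          gcongr
          rw [← div_eq_mul_inv, div_le_one hq]; linarith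
      _ = _ := by ring
  have hπ : ∫⁻ s : ℝ, ENNReal.ofReal ((1 + s ^ 2)⁻¹) = ENNReal.ofReal Real.pi := by
    rw [← ofReal_integral_eq_lintegral_ofReal integrable_inv_one_add_sq
      (Eventually.of_forall fun s => by positivity), integral_univ_inv_one_add_sq]
  calc _ ≤ ∫⁻ s in Set.Ioi (0 : ℝ), (ENNReal.ofReal (8 * Real.pi ^ 2) * ‖𝓕 (oddPart g φ) s‖ₑ ^ 2 +
        ENNReal.ofReal K * ENNReal.ofReal ((1 + s ^ 2)⁻¹)) :=
        setLIntegral_mono' measurableSet_Ioi hpt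
    _ ≤ ∫⁻ s : ℝ, (ENNReal.ofReal (8 * Real.pi ^ 2) * ‖𝓕 (oddPart g φ) s‖ₑ ^ 2 +
        ENNReal.ofReal K * ENNReal.ofReal ((1 + s ^ 2)⁻¹)) := setLIntegral_le_lintegral _ _
    _ = ENNReal.ofReal (8 * Real.pi ^ 2) * (∫⁻ s, ‖𝓕 (oddPart g φ) s‖ₑ ^ 2) +
        ENNReal.ofReal K * ENNReal.ofReal Real.pi := by
        rw [lintegral_add_right _ (by fun_prop), lintegral_const_mul' _ _ ENNReal.ofReal_ne_top,
          lintegral_const_mul' _ _ ENNReal.ofReal_ne_top, hπ]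
    _ ≤ ENNReal.ofReal (8 * Real.pi ^ 2) *
          (∫⁻ p in Set.Icc (-1 : ℝ) 1, ‖halfPlaneTransform g p φ‖ₑ ^ 2) +
        (ENNReal.ofReal (32 * Real.pi) *
          (∫⁻ p in Set.Icc (-1 : ℝ) 1, ‖halfPlaneTransform g p φ‖ₑ ^ 2) +
        ENNReal.ofReal (4 * Real.pi) * ‖∫ y, g y‖ₑ ^ 2) := by
        refine add_le_add ?_ ?_
        · exact mul_le_mul_right (lintegral_enorm_fourier_oddPart_le hg hm φ) _
        · rw [← ENNReal.ofReal_mul hK0, show K * Real.pi = 16 * Real.pi *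
            |halfPlaneTransform g 1 φ| ^ 2 + 4 * Real.pi * |∫ y, g y| ^ 2 by rw [hK]; ring,
            ENNReal.ofReal_add (by positivity) (by positivity),
            ENNReal.ofReal_mul (p := 16 * Real.pi) (by positivity),
            ENNReal.ofReal_mul (p := 4 * Real.pi) (by positivity), ← hsq', ← hsq']
          refine add_le_add_left ?_ _
          rw [show 32 * Real.pi = 16 * Real.pi * 2 by ring,
            ENNReal.ofReal_mul (p := 16 * Real.pi) (by positivity), mul_assoc]
          have h2 := enorm_halfPlaneTransform_one_sq_le hr hs φ
          rw [← ENNReal.ofReal_ofNat] at h2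
          exact mul_le_mul_right h2 (ENNReal.ofReal (16 * Real.pi))
    _ = _ := by
        rw [ENNReal.ofReal_add (by positivity) (by positivity)]; ring

/-- The half-plane transform controls the `H^{-3/2}` norm. -/
theorem exists_lintegral_fourier_le (hr : 1 < r) : ∃ C : ℝ≥0∞, C ≠ ⊤ ∧ ∀ g : Plane → ℝ,
    Integrable g → Measurable g → (∀ y, g y ≠ 0 → y ∈ invDisc r) →
    ∫⁻ ξ : Plane, ENNReal.ofReal ((1 + ‖ξ‖ ^ 2) ^ (-(3 / 2) : ℝ)) *
        ‖𝓕 (fun y => (g y : ℂ)) ξ‖ₑ ^ 2 ≤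
      C * ∫⁻ φ in Set.Ioo 0 (2 * Real.pi), ∫⁻ p in Set.Icc (-1 : ℝ) 1,
        ‖halfPlaneTransform g p φ‖ₑ ^ 2 := by
  refine ⟨ENNReal.ofReal (8 * Real.pi ^ 2 + 32 * Real.pi) +
    ENNReal.ofReal (2 * Real.pi) * (ENNReal.ofReal (4 * Real.pi) *
      (4 * (volume (freeAngles r))⁻¹)), ?_, fun g hg hm hs => ?_⟩
  · have := volume_freeAngles_ne_zero r
    finiteness
  have hF : Measurable (𝓕 (fun y => (g y : ℂ))) := (continuous_fourier hg.ofReal).measurable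
  rw [lintegral_polar (by fun_prop)]
  set N : ℝ≥0∞ := ∫⁻ φ in Set.Ioo 0 (2 * Real.pi), ∫⁻ p in Set.Icc (-1 : ℝ) 1,
        ‖halfPlaneTransform g p φ‖ₑ ^ 2 with hN
  calc _ ≤ ∫⁻ φ in Set.Ioo 0 (2 * Real.pi),
      (ENNReal.ofReal (8 * Real.pi ^ 2 + 32 * Real.pi) *
        (∫⁻ p in Set.Icc (-1 : ℝ) 1, ‖halfPlaneTransform g p φ‖ₑ ^ 2) +
      ENNReal.ofReal (4 * Real.pi) * ‖∫ y, g y‖ₑ ^ 2) :=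
        lintegral_mono fun φ => lintegral_radial_fourier_le hr hg hm hs φ
    _ = ENNReal.ofReal (8 * Real.pi ^ 2 + 32 * Real.pi) * N +
        ENNReal.ofReal (2 * Real.pi) * (ENNReal.ofReal (4 * Real.pi) * ‖∫ y, g y‖ₑ ^ 2) := by
        rw [lintegral_add_right _ measurable_const, lintegral_const_mul' _ _ ENNReal.ofReal_ne_top,
          setLIntegral_const, Real.volume_Ioo, sub_zero, mul_comm (ENNReal.ofReal (2 * Real.pi))]
    _ ≤ ENNReal.ofReal (8 * Real.pi ^ 2 + 32 * Real.pi) * N +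
        ENNReal.ofReal (2 * Real.pi) * (ENNReal.ofReal (4 * Real.pi) *
          (4 * (volume (freeAngles r))⁻¹ * N)) := by
        gcongr
        exact enorm_integral_sq_le hr hs
    _ = _ := by ring

end HalfPlaneEstimates

/-! ### Two-sided bounds for the Fourier multiplier of the Gagliardo seminorm. -/

section Multiplier

open FourierTransform

theorem setLIntegral_Ioc_rpow {a q : ℝ} (ha : 0 < a) (hq : -1 < q) :
    ∫⁻ s in Set.Ioc 0 a, ENNReal.ofReal (s ^ q) = ENNReal.ofReal (a ^ (q + 1) / (q + 1)) := by
  have hi : IntegrableOn (fun s : ℝ => s ^ q) (Set.Ioc 0 a) :=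
    (intervalIntegrable_iff_integrableOn_Ioc_of_le ha.le).1
      (intervalIntegral.intervalIntegrable_rpow' hq)
  rw [← ofReal_integral_eq_lintegral_ofReal hi, ← intervalIntegral.integral_of_le ha.le,
    integral_rpow (.inl hq), Real.zero_rpow (by linarith), sub_zero]
  filter_upwards [ae_restrict_mem measurableSet_Ioc] with s hs
  exact Real.rpow_nonneg hs.1.le q

theorem setLIntegral_Ioi_rpow {a q : ℝ} (ha : 0 < a) (hq : q < -1) :
    ∫⁻ s in Set.Ioi a, ENNReal.ofReal (s ^ q) = ENNReal.ofReal (-a ^ (q + 1) / (q + 1)) := by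
  rw [← ofReal_integral_eq_lintegral_ofReal (integrableOn_Ioi_rpow_of_lt hq ha),
    integral_Ioi_rpow_of_lt hq ha]
  filter_upwards [ae_restrict_mem measurableSet_Ioi] with s hs
  exact Real.rpow_nonneg (ha.le.trans (le_of_lt hs)) q

theorem lintegral_comp_norm {h : ℝ → ℝ≥0∞} (hh : Measurable h) :
    ∫⁻ u : Plane, h ‖u‖ =
      ENNReal.ofReal (2 * Real.pi) * ∫⁻ s in Set.Ioi (0 : ℝ), ENNReal.ofReal s * h s := by
  rw [lintegral_polar (by fun_prop)]
  have : ∀ φ : ℝ, ∫⁻ s in Set.Ioi (0 : ℝ), ENNReal.ofReal s * h ‖s • dir φ‖ =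
      ∫⁻ s in Set.Ioi (0 : ℝ), ENNReal.ofReal s * h s := fun φ =>
    setLIntegral_congr_fun measurableSet_Ioi fun s hs => by
      simp only [norm_smul, norm_dir, mul_one, Real.norm_eq_abs, abs_of_pos hs.out]
  simp only [this]
  rw [setLIntegral_const, Real.volume_Ioo, sub_zero, mul_comm]

/-- The squared modulus of `exp (2πi u·ξ) - 1`. -/
noncomputable def diffSymbol (u ξ : Plane) : ℝ := 4 * Real.sin (Real.pi * inner ℝ u ξ) ^ 2

/-- Translation by `u` multiplies the transform by `exp (2πi u·ξ)`; apply Plancherel to the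
difference. -/
theorem lintegral_diff_sq {F : Plane → ℂ} (h1 : Integrable F) (h2 : MemLp F 2) (u : Plane) :
    ∫⁻ y, ‖F (y + u) - F y‖ₑ ^ 2 = ∫⁻ ξ, ENNReal.ofReal (diffSymbol u ξ) * ‖𝓕 F ξ‖ₑ ^ 2 := by
  have h1' : Integrable fun y => F (y + u) := h1.comp_add_right u
  have h2' : MemLp (fun y => F (y + u)) 2 :=
    h2.comp_measurePreserving (measurePreserving_add_right volume u)
  rw [← lintegral_enorm_fourier_sq (F := fun y => F (y + u) - F y) (h1'.sub h1) (h2'.sub h2)]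
  congr 1; ext ξ
  have e1 : 𝓕 (fun y => F (y + u)) ξ =
      Complex.exp (Complex.I * ((2 * Real.pi * inner ℝ u ξ : ℝ) : ℂ)) * 𝓕 F ξ := by
    have := congrFun (VectorFourier.fourierIntegral_comp_add_right Real.fourierChar
      (volume : Measure Plane) (innerₗ Plane) F u) ξ
    refine this.trans ?_
    rw [innerₗ_apply_apply, Circle.smul_def, Real.fourierChar_apply, smul_eq_mul, mul_comm Complex.I]
    rfl
  have e2 : 𝓕 (fun y => F (y + u) - F y) ξ =
      (Complex.exp (Complex.I * ((2 * Real.pi * inner ℝ u ξ : ℝ) : ℂ)) - 1) * 𝓕 F ξ := by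
    rw [sub_mul, one_mul, ← e1, Real.fourier_eq, Real.fourier_eq, Real.fourier_eq,
      ← integral_sub]
    · simp only [smul_sub]
    · exact (Real.fourierIntegral_convergent_iff ξ).2 h1'
    · exact (Real.fourierIntegral_convergent_iff ξ).2 h1
  rw [e2, enorm_mul, mul_pow, ← ofReal_norm (_ - _), Complex.norm_exp_I_mul_ofReal_sub_one,
    ← ENNReal.ofReal_pow (norm_nonneg _), diffSymbol, Real.norm_eq_abs, sq_abs]
  congr 2
  rw [mul_pow]
  congr 2
  · norm_num
  · congr 1; ring

theorem diffSymbol_le_four (u ξ : Plane) : diffSymbol u ξ ≤ 4 := by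
  unfold diffSymbol
  have := Real.sin_sq_le_one (Real.pi * inner ℝ u ξ)
  linarith

theorem diffSymbol_le (u ξ : Plane) : diffSymbol u ξ ≤ 4 * Real.pi ^ 2 * (‖u‖ * ‖ξ‖) ^ 2 := by
  unfold diffSymbol
  have h1 : |Real.sin (Real.pi * inner ℝ u ξ)| ≤ Real.pi * (‖u‖ * ‖ξ‖) := by
    refine Real.abs_sin_le_abs.trans ?_
    rw [abs_mul, abs_of_pos Real.pi_pos]
    exact mul_le_mul_of_nonneg_left (abs_real_inner_le_norm u ξ) Real.pi_pos.le
  have h2 := pow_le_pow_left₀ (abs_nonneg _) h1 2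
  rw [sq_abs] at h2
  nlinarith

theorem continuous_diffSymbol : Continuous fun z : Plane × Plane => diffSymbol z.1 z.2 := by
  unfold diffSymbol
  fun_prop

/-- The Gagliardo weight `‖u‖^(-2-2β)`. -/
noncomputable def gagliardoWeight (β : ℝ) (u : Plane) : ℝ≥0∞ := ENNReal.ofReal (‖u‖ ^ (-2 - 2 * β))

theorem measurable_gagliardoWeight (β : ℝ) : Measurable (gagliardoWeight β) := by
  unfold gagliardoWeight
  fun_prop

/-- The integral is split at `‖u‖ = 1 / L`, with `L² = 1 + ‖ξ‖²`. Inside, the quadratic bound on the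
symbol is integrable since `β < 1`; outside, the bound `4` is integrable since `β > 0`. Both pieces
scale as `L ^ (2 * β)`. -/
theorem exists_lintegral_diffSymbol_le {β : ℝ} (hβ0 : 0 < β) (hβ1 : β < 1) :
    ∃ C : ℝ≥0∞, C ≠ ⊤ ∧ ∀ ξ : Plane,
      ∫⁻ u, gagliardoWeight β u * ENNReal.ofReal (diffSymbol u ξ) ≤
        C * ENNReal.ofReal ((1 + ‖ξ‖ ^ 2) ^ β) := by
  refine ⟨ENNReal.ofReal (2 * Real.pi) *
    ENNReal.ofReal (4 * Real.pi ^ 2 / (2 - 2 * β) + 4 / (2 * β)), by finiteness, fun ξ => ?_⟩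
  set L : ℝ := Real.sqrt (1 + ‖ξ‖ ^ 2) with hL
  have hL2 : L ^ 2 = 1 + ‖ξ‖ ^ 2 := Real.sq_sqrt (by positivity)
  have hL0 : 0 < L := Real.sqrt_pos.2 (by positivity)
  have hLξ : ‖ξ‖ ≤ L := Real.le_sqrt_of_sq_le (by linarith)
  set h : ℝ → ℝ≥0∞ := fun s => ENNReal.ofReal (s ^ (-2 - 2 * β)) *
    ENNReal.ofReal (min 4 (4 * Real.pi ^ 2 * (s * L) ^ 2)) with hh
  have hhm : Measurable h := by fun_prop
  have hpow : (1 + ‖ξ‖ ^ 2) ^ β = L ^ (2 * β) := by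
    rw [← hL2, ← Real.rpow_natCast, ← Real.rpow_mul hL0.le]; norm_num
  calc ∫⁻ u, gagliardoWeight β u * ENNReal.ofReal (diffSymbol u ξ)
      ≤ ∫⁻ u : Plane, h ‖u‖ := by
        refine lintegral_mono fun u => ?_
        simp only [hh, gagliardoWeight]
        gcongr
        refine le_min (diffSymbol_le_four u ξ) ((diffSymbol_le u ξ).trans ?_)
        gcongr
    _ = ENNReal.ofReal (2 * Real.pi) * ∫⁻ s in Set.Ioi (0 : ℝ), ENNReal.ofReal s * h s :=
        lintegral_comp_norm hhm
    _ ≤ ENNReal.ofReal (2 * Real.pi) *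
        (ENNReal.ofReal (4 * Real.pi ^ 2 / (2 - 2 * β) + 4 / (2 * β)) *
          ENNReal.ofReal ((1 + ‖ξ‖ ^ 2) ^ β)) := by
        refine mul_le_mul_right ?_ _
        rw [← Set.Ioc_union_Ioi_eq_Ioi (inv_pos.2 hL0).le, lintegral_union measurableSet_Ioi
          (Set.disjoint_left.2 fun s hs hs' => hs'.out.not_ge hs.2)]
        have hA : ∫⁻ s in Set.Ioc 0 L⁻¹, ENNReal.ofReal s * h s ≤
            ENNReal.ofReal (4 * Real.pi ^ 2 / (2 - 2 * β) * L ^ (2 * β)) := by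
          calc ∫⁻ s in Set.Ioc 0 L⁻¹, ENNReal.ofReal s * h s
              ≤ ∫⁻ s in Set.Ioc 0 L⁻¹, ENNReal.ofReal (4 * Real.pi ^ 2 * L ^ 2) *
                  ENNReal.ofReal (s ^ (1 - 2 * β)) := by
                refine setLIntegral_mono' measurableSet_Ioc fun s hs => ?_
                have hs0 : 0 < s := hs.1
                simp only [hh]
                rw [← ENNReal.ofReal_mul (by positivity), ← ENNReal.ofReal_mul (by positivity),
                  ← ENNReal.ofReal_mul (by positivity)]
                refine ENNReal.ofReal_le_ofReal ?_
                calc s * (s ^ (-2 - 2 * β) * min 4 (4 * Real.pi ^ 2 * (s * L) ^ 2))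
                    ≤ s * (s ^ (-2 - 2 * β) * (4 * Real.pi ^ 2 * (s * L) ^ 2)) := by
                      gcongr; exact min_le_right _ _
                  _ = 4 * Real.pi ^ 2 * L ^ 2 * (s ^ (-2 - 2 * β) * s ^ 3) := by ring
                  _ = _ := by
                      rw [← Real.rpow_natCast s 3, ← Real.rpow_add hs0]
                      congr 2; push_cast; ring
            _ = _ := by
                rw [lintegral_const_mul' _ _ ENNReal.ofReal_ne_top,
                  setLIntegral_Ioc_rpow (inv_pos.2 hL0) (by linarith),
                  ← ENNReal.ofReal_mul (by positivity)]
                congr 1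
                rw [show (1 - 2 * β + 1) = 2 - 2 * β by ring, Real.inv_rpow hL0.le,
                  ← Real.rpow_neg hL0.le, show 2 * β = 2 + -(2 - 2 * β) by ring,
                  Real.rpow_add hL0, Real.rpow_two]
                ring_nf
        have hB : ∫⁻ s in Set.Ioi L⁻¹, ENNReal.ofReal s * h s ≤
            ENNReal.ofReal (4 / (2 * β) * L ^ (2 * β)) := by
          calc ∫⁻ s in Set.Ioi L⁻¹, ENNReal.ofReal s * h s
              ≤ ∫⁻ s in Set.Ioi L⁻¹, ENNReal.ofReal 4 * ENNReal.ofReal (s ^ (-1 - 2 * β)) := by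
                refine setLIntegral_mono' measurableSet_Ioi fun s hs => ?_
                have hs0 : 0 < s := (inv_pos.2 hL0).trans hs
                simp only [hh]
                rw [← ENNReal.ofReal_mul (by positivity), ← ENNReal.ofReal_mul (by positivity),
                  ← ENNReal.ofReal_mul (by positivity)]
                refine ENNReal.ofReal_le_ofReal ?_
                calc s * (s ^ (-2 - 2 * β) * min 4 (4 * Real.pi ^ 2 * (s * L) ^ 2))
                    ≤ s * (s ^ (-2 - 2 * β) * 4) := by gcongr; exact min_le_left _ _
                  _ = 4 * (s ^ (1 : ℝ) * s ^ (-2 - 2 * β)) := by rw [Real.rpow_one]; ring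
                  _ = _ := by
                      rw [← Real.rpow_add hs0]
                      congr 2; ring
            _ = _ := by
                rw [lintegral_const_mul' _ _ ENNReal.ofReal_ne_top,
                  setLIntegral_Ioi_rpow (inv_pos.2 hL0) (by linarith),
                  ← ENNReal.ofReal_mul (by positivity)]
                congr 1
                rw [show (-1 - 2 * β + 1) = -(2 * β) by ring, Real.inv_rpow hL0.le,
                  ← Real.rpow_neg hL0.le, neg_neg, neg_div_neg_eq]
                ring
        refine (add_le_add hA hB).trans_eq ?_
        have : 0 < 2 - 2 * β := by linarith
        rw [← ENNReal.ofReal_add (by positivity) (by positivity),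
          ← ENNReal.ofReal_mul (by positivity), hpow]
        congr 1; ring
    _ = _ := by ring

theorem le_setLIntegral_diffSymbol {β δ : ℝ} (hβ0 : 0 < β) (hδ : 0 < δ) {ξ : Plane}
    (hξ : δ⁻¹ ≤ ‖ξ‖) :
    ENNReal.ofReal (Real.pi / 256 * ‖ξ‖ ^ (2 * β)) ≤
      ∫⁻ u in Metric.closedBall 0 δ, gagliardoWeight β u * ENNReal.ofReal (diffSymbol u ξ) := by
  set L := ‖ξ‖ with hL
  have hL0 : 0 < L := (inv_pos.2 hδ).trans_le hξ
  have hδL : L⁻¹ ≤ δ := inv_le_of_inv_le₀ hδ hξ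
  -- At this centre `u · ξ = 1/4`; on the ball of radius `1 / (8 L)` it stays in `[1/8, 3/8]`, where
  -- Jordan's inequality bounds the sine below by `1/4`. The constant `π / 256` is the ball's area
  -- `π / (64 L²)` times `L² / 4`.
  set a : Plane := (4 * L ^ 2)⁻¹ • ξ with ha
  have hna : ‖a‖ = 1 / (4 * L) := by
    rw [ha, norm_smul, ← hL, Real.norm_of_nonneg (by positivity)]; field_simp
  have hb : ∀ u ∈ Metric.ball a (1 / (8 * L)), u ∈ Metric.closedBall (0 : Plane) δ ∧
      ENNReal.ofReal (L ^ (2 + 2 * β) * (1 / 4)) ≤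
        gagliardoWeight β u * ENNReal.ofReal (diffSymbol u ξ) := by
    intro u hu
    rw [Metric.mem_ball, dist_eq_norm] at hu
    have hsplit : inner ℝ u ξ = 1 / 4 + inner ℝ (u - a) ξ := by
      rw [inner_sub_left, ha, real_inner_smul_left, real_inner_self_eq_norm_sq, ← hL]
      field_simp
      ring
    have hi : |inner ℝ (u - a) ξ| ≤ 1 / 8 := by
      refine (abs_real_inner_le_norm _ _).trans ?_
      rw [← hL]
      calc ‖u - a‖ * L ≤ 1 / (8 * L) * L := by gcongr
        _ = 1 / 8 := by field_simp
    rw [abs_le] at hi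
    have hu1 : ‖u‖ ≤ L⁻¹ := by
      calc ‖u‖ = ‖a + (u - a)‖ := by congr 1; abel
        _ ≤ ‖a‖ + ‖u - a‖ := norm_add_le _ _
        _ ≤ 1 / (4 * L) + 1 / (8 * L) := by rw [hna]; gcongr
        _ = 3 / 8 * L⁻¹ := by field_simp; norm_num
        _ ≤ L⁻¹ := mul_le_of_le_one_left (by positivity) (by norm_num)
    have hu0 : 0 < ‖u‖ := by
      rw [norm_pos_iff]
      rintro rfl
      rw [inner_zero_left] at hsplit
      linarith [hi.1]
    refine ⟨by simpa using hu1.trans hδL, ?_⟩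
    rw [gagliardoWeight, ← ENNReal.ofReal_mul (by positivity)]
    refine ENNReal.ofReal_le_ofReal (mul_le_mul ?_ ?_ (by norm_num) (by positivity))
    · calc L ^ (2 + 2 * β) = L⁻¹ ^ (-2 - 2 * β) := by
            rw [Real.inv_rpow hL0.le, ← Real.rpow_neg hL0.le]; congr 1; ring
        _ ≤ ‖u‖ ^ (-2 - 2 * β) := Real.rpow_le_rpow_of_nonpos hu0 hu1 (by linarith)
    · have h1 : 1 / 4 ≤ Real.sin (Real.pi * inner ℝ u ξ) := by
        have h2 : 2 / Real.pi * (Real.pi * inner ℝ u ξ) ≤ Real.sin (Real.pi * inner ℝ u ξ) :=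
          Real.mul_le_sin (mul_nonneg Real.pi_pos.le (by linarith [hi.1]))
            (by nlinarith [hi.2, Real.pi_pos])
        have h3 : 2 / Real.pi * (Real.pi * inner ℝ u ξ) = 2 * inner ℝ u ξ := by
          field_simp
        linarith [hi.1]
      unfold diffSymbol
      nlinarith
  calc ENNReal.ofReal (Real.pi / 256 * L ^ (2 * β))
      = ∫⁻ u in Metric.ball a (1 / (8 * L)), ENNReal.ofReal (L ^ (2 + 2 * β) * (1 / 4)) := by
        rw [setLIntegral_const, EuclideanSpace.volume_ball_fin_two,
          ← ENNReal.ofReal_pow (by positivity), ← ENNReal.ofReal_mul (by positivity),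
          ← ENNReal.ofReal_mul (by positivity), Real.rpow_add hL0, Real.rpow_two]
        congr 1
        field_simp
        norm_num
    _ ≤ ∫⁻ u in Metric.ball a (1 / (8 * L)),
          gagliardoWeight β u * ENNReal.ofReal (diffSymbol u ξ) :=
        setLIntegral_mono' measurableSet_ball fun u hu => (hb u hu).2
    _ ≤ _ := lintegral_mono_set fun u hu => (hb u hu).1

end Multiplier

/-! ### Comparison of the `H^β` norm with Gagliardo seminorms. -/

section Gagliardo

open FourierTransform

/-- The square of the Gagliardo seminorm of order `β`. -/
noncomputable def gagliardo (β : ℝ) (f : Plane → ℝ) : ℝ≥0∞ :=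
  ∫⁻ x, ∫⁻ y, gagliardoWeight β (y - x) * ‖f y - f x‖ₑ ^ 2

/-- The square of the Gagliardo seminorm of order `β`, restricted to differences of length at
most `δ`. -/
noncomputable def localGagliardo (β δ : ℝ) (f : Plane → ℝ) : ℝ≥0∞ :=
  ∫⁻ x, ∫⁻ u in Metric.closedBall 0 δ, gagliardoWeight β u * ‖f (x + u) - f x‖ₑ ^ 2

/-- Tonelli, Plancherel for each fixed shift `u`, and Tonelli again. A general set of shifts serves
both the full and the local seminorm. -/
theorem setLIntegral_gagliardo_eq_fourier {f : Plane → ℝ} (hm : Measurable f) (h1 : Integrable f)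
    (h2 : MemLp f 2) (β : ℝ) (s : Set Plane) :
    ∫⁻ x, ∫⁻ u in s, gagliardoWeight β u * ‖f (x + u) - f x‖ₑ ^ 2 =
      ∫⁻ ξ, (∫⁻ u in s, gagliardoWeight β u * ENNReal.ofReal (diffSymbol u ξ)) *
        ‖𝓕 (fun y => (f y : ℂ)) ξ‖ₑ ^ 2 := by
  have hw := measurable_gagliardoWeight β
  have hF : Measurable (𝓕 (fun y => (f y : ℂ))) := (continuous_fourier h1.ofReal).measurable
  have hd : Measurable fun z : Plane × Plane => diffSymbol z.1 z.2 :=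
    continuous_diffSymbol.measurable
  have hd' : Measurable fun z : Plane × Plane => diffSymbol z.2 z.1 := by
    unfold diffSymbol; fun_prop
  rw [lintegral_lintegral_swap (by fun_prop)]
  have e : ∀ u, ∫⁻ x, gagliardoWeight β u * ‖f (x + u) - f x‖ₑ ^ 2 =
      ∫⁻ ξ, gagliardoWeight β u * ENNReal.ofReal (diffSymbol u ξ) *
        ‖𝓕 (fun y => (f y : ℂ)) ξ‖ₑ ^ 2 := by
    intro u
    simp only [mul_assoc]
    rw [lintegral_const_mul _ (by fun_prop),
      lintegral_const_mul' (gagliardoWeight β u) _ ENNReal.ofReal_ne_top,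
      ← lintegral_diff_sq (F := fun y => (f y : ℂ)) h1.ofReal h2.ofReal]
    congr 1
    refine lintegral_congr fun x => ?_
    rw [← Complex.ofReal_sub, ← ofReal_norm, ← ofReal_norm, Complex.norm_real]
  simp only [e]
  rw [lintegral_lintegral_swap (by fun_prop)]
  refine lintegral_congr fun ξ => ?_
  rw [lintegral_mul_const _ (by fun_prop)]

theorem exists_gagliardo_le {β : ℝ} (hβ0 : 0 < β) (hβ1 : β < 1) :
    ∃ C : ℝ≥0∞, C ≠ ⊤ ∧ ∀ f : Plane → ℝ, Measurable f → Integrable f → MemLp f 2 →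
      gagliardo β f ≤ C * ∫⁻ ξ, ENNReal.ofReal ((1 + ‖ξ‖ ^ 2) ^ β) *
        ‖𝓕 (fun y => (f y : ℂ)) ξ‖ₑ ^ 2 := by
  obtain ⟨C, hC, h⟩ := exists_lintegral_diffSymbol_le hβ0 hβ1
  refine ⟨C, hC, fun f hm h1 h2 => ?_⟩
  have e : gagliardo β f =
      ∫⁻ x, ∫⁻ u in Set.univ, gagliardoWeight β u * ‖f (x + u) - f x‖ₑ ^ 2 := by
    refine lintegral_congr fun x => ?_
    rw [← lintegral_add_left_eq_self _ x]
    simp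
  rw [e, setLIntegral_gagliardo_eq_fourier hm h1 h2 β Set.univ,
    ← lintegral_const_mul' _ _ hC]
  refine lintegral_mono fun ξ => ?_
  rw [← mul_assoc, Measure.restrict_univ]
  exact mul_le_mul_left (h ξ) _

/-- Short differences detect frequencies `‖ξ‖ ≥ δ⁻¹`; lower frequencies have a bounded weight and
are paid for by the `L²` norm. -/
theorem exists_lintegral_fourier_le_localGagliardo {β δ : ℝ} (hβ0 : 0 < β) (hβ1 : β < 1)
    (hδ : 0 < δ) :
    ∃ C : ℝ≥0∞, C ≠ ⊤ ∧ ∀ f : Plane → ℝ, Measurable f → Integrable f → MemLp f 2 →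
      ∫⁻ ξ, ENNReal.ofReal ((1 + ‖ξ‖ ^ 2) ^ β) * ‖𝓕 (fun y => (f y : ℂ)) ξ‖ₑ ^ 2 ≤
        C * ((∫⁻ x, ‖f x‖ₑ ^ 2) + localGagliardo β δ f) := by
  set R : ℝ := max 1 δ⁻¹
  set C1 : ℝ≥0∞ := ENNReal.ofReal ((1 + R ^ 2) ^ β)
  set C2 : ℝ≥0∞ := ENNReal.ofReal (2 * (256 / Real.pi))
  refine ⟨C1 + C2, by finiteness, fun f hm h1 h2 => ?_⟩
  have hF : Measurable (𝓕 (fun y => (f y : ℂ))) := (continuous_fourier h1.ofReal).measurable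
  set Λ : Plane → ℝ≥0∞ := fun ξ =>
    ∫⁻ u in Metric.closedBall 0 δ, gagliardoWeight β u * ENNReal.ofReal (diffSymbol u ξ) with hΛ
  have hpt : ∀ ξ : Plane, ENNReal.ofReal ((1 + ‖ξ‖ ^ 2) ^ β) ≤ C1 + C2 * Λ ξ := by
    intro ξ
    rcases le_total ‖ξ‖ R with hξ | hξ
    · refine le_add_right (ENNReal.ofReal_le_ofReal ?_)
      gcongr
    · refine le_add_left ?_
      have hL1 : 1 ≤ ‖ξ‖ := (le_max_left _ _).trans hξ
      refine le_trans ?_ (mul_le_mul_right (le_setLIntegral_diffSymbol hβ0 hδ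
        ((le_max_right _ _).trans hξ)) C2)
      rw [← ENNReal.ofReal_mul (by positivity)]
      refine ENNReal.ofReal_le_ofReal ?_
      calc (1 + ‖ξ‖ ^ 2) ^ β ≤ (2 * ‖ξ‖ ^ 2) ^ β := by
            gcongr
            nlinarith
        _ = 2 ^ β * ‖ξ‖ ^ (2 * β) := by
            rw [Real.mul_rpow (by norm_num) (by positivity), ← Real.rpow_natCast, ← Real.rpow_mul
              (norm_nonneg _)]
            norm_num
        _ ≤ 2 ^ (1 : ℝ) * ‖ξ‖ ^ (2 * β) := by
            gcongr
            norm_num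
        _ = _ := by
            rw [Real.rpow_one]; field_simp
  have hplanch : ∫⁻ ξ, ‖𝓕 (fun y => (f y : ℂ)) ξ‖ₑ ^ 2 = ∫⁻ x, ‖f x‖ₑ ^ 2 := by
    rw [lintegral_enorm_fourier_sq (F := fun y => (f y : ℂ)) h1.ofReal h2.ofReal]
    refine lintegral_congr fun x => ?_
    rw [← ofReal_norm, ← ofReal_norm, Complex.norm_real]
  calc _ ≤ ∫⁻ ξ, (C1 * ‖𝓕 (fun y => (f y : ℂ)) ξ‖ₑ ^ 2 +
        C2 * (Λ ξ * ‖𝓕 (fun y => (f y : ℂ)) ξ‖ₑ ^ 2)) := by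
        refine lintegral_mono fun ξ => ?_
        rw [← mul_assoc, ← add_mul]
        exact mul_le_mul_left (hpt ξ) _
    _ = C1 * (∫⁻ x, ‖f x‖ₑ ^ 2) + C2 * localGagliardo β δ f := by
        rw [lintegral_add_left (by fun_prop), lintegral_const_mul' _ _ ENNReal.ofReal_ne_top,
          lintegral_const_mul' _ _ ENNReal.ofReal_ne_top, hplanch, localGagliardo,
          setLIntegral_gagliardo_eq_fourier hm h1 h2 β _]
    _ ≤ (C1 + C2) * (∫⁻ x, ‖f x‖ₑ ^ 2) + (C1 + C2) * localGagliardo β δ f := by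
        gcongr
        · exact le_self_add
        · exact le_add_self
    _ = _ := by ring

end Gagliardo

/-! ### Boundedness of the inversion pullback in the Gagliardo seminorm. -/

section Transfer

variable {r : ℝ} {f : Plane → ℝ}

theorem pullback_mem_invDisc (hr : 1 < r) (hs : ∀ x, f x ≠ 0 → x ∈ detectorDisc r) {y : Plane}
    (hy : pullback f y ≠ 0) : y ∈ invDisc r := by
  have h := hs _ (right_ne_zero_of_mul hy)
  rwa [← circInv_mem_invDisc_iff (by linarith), circInv_circInv] at h

theorem measurable_pullback (hm : Measurable f) : Measurable (pullback f) := by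
  have := measurable_circInv
  unfold pullback
  fun_prop

theorem inv_norm_pow_bounds {R : ℝ} (hR : 0 < R) {y : Plane} (hy : y ∈ annulus R) :
    0 < ‖y‖ ∧ ‖y‖⁻¹ ≤ R := by
  have h0 : 0 < ‖y‖ := norm_pos_iff.2 (ne_zero_of_mem_annulus hR hy)
  exact ⟨h0, inv_le_of_inv_le₀ hR hy.1⟩

theorem inv_norm_pow_le {R : ℝ} (hR : 0 < R) {y : Plane} (hy : y ∈ annulus R) :
    (‖y‖ ^ 4)⁻¹ ≤ R ^ 4 := by
  obtain ⟨h0, h1⟩ := inv_norm_pow_bounds hR hy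
  rw [← inv_pow]
  gcongr

theorem abs_inv_norm_pow_sub_le {R : ℝ} (hR : 0 < R) {y z : Plane} (hy : y ∈ annulus R)
    (hz : z ∈ annulus R) : |(‖z‖ ^ 4)⁻¹ - (‖y‖ ^ 4)⁻¹| ≤ 4 * R ^ 5 * ‖z - y‖ := by
  obtain ⟨hy0, hy1⟩ := inv_norm_pow_bounds hR hy
  obtain ⟨hz0, hz1⟩ := inv_norm_pow_bounds hR hz
  have h1 : |‖z‖⁻¹ - ‖y‖⁻¹| ≤ R ^ 2 * ‖z - y‖ := by
    have e : ‖z‖⁻¹ - ‖y‖⁻¹ = ‖z‖⁻¹ * ‖y‖⁻¹ * (‖y‖ - ‖z‖) := by field_simp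
    rw [e, abs_mul, abs_of_pos (by positivity), sq, norm_sub_rev]
    gcongr
    exact abs_norm_sub_norm_le y z
  have e : (‖z‖ ^ 4)⁻¹ - (‖y‖ ^ 4)⁻¹ =
      (‖z‖⁻¹ - ‖y‖⁻¹) * ((‖z‖⁻¹ + ‖y‖⁻¹) * (‖z‖⁻¹ ^ 2 + ‖y‖⁻¹ ^ 2)) := by
    rw [← inv_pow, ← inv_pow]; ring
  rw [e, abs_mul, abs_of_pos (a := (‖z‖⁻¹ + ‖y‖⁻¹) * _) (by positivity)]
  calc |‖z‖⁻¹ - ‖y‖⁻¹| * ((‖z‖⁻¹ + ‖y‖⁻¹) * (‖z‖⁻¹ ^ 2 + ‖y‖⁻¹ ^ 2))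
      ≤ R ^ 2 * ‖z - y‖ * ((R + R) * (R ^ 2 + R ^ 2)) := by gcongr
    _ = _ := by ring

theorem pullback_diff_le {R β : ℝ} (hR : 0 < R) (hβ0 : 0 < β) (f : Plane → ℝ) {y z : Plane}
    (hy : y ∈ annulus R) (hz : z ∈ annulus R) :
    ‖z - y‖ ^ (-2 - 2 * β) * (pullback f z - pullback f y) ^ 2 ≤
      2 * R ^ 8 * R ^ (2 * (2 + 2 * β)) * (‖circInv z - circInv y‖ ^ (-2 - 2 * β) *
        (f (circInv z) - f (circInv y)) ^ 2) +
      32 * R ^ 10 * (f (circInv y) ^ 2 * ‖z - y‖ ^ (-2 * β)) := by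
  rcases eq_or_ne z y with rfl | hzy
  · simp
    positivity
  have hd : 0 < ‖z - y‖ := norm_pos_iff.2 (sub_ne_zero.2 hzy)
  obtain ⟨hy0, hy1⟩ := inv_norm_pow_bounds hR hy
  obtain ⟨hz0, hz1⟩ := inv_norm_pow_bounds hR hz
  have hdist := norm_circInv_sub_circInv (ne_zero_of_mem_annulus hR hz)
    (ne_zero_of_mem_annulus hR hy)
  have hd' : 0 < ‖circInv z - circInv y‖ := by rw [hdist]; positivity
  have hle : ‖circInv z - circInv y‖ ≤ R ^ 2 * ‖z - y‖ := by
    rw [hdist, mul_inv, sq]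
    gcongr
  have hk : ‖z - y‖ ^ (-2 - 2 * β) ≤
      R ^ (2 * (2 + 2 * β)) * ‖circInv z - circInv y‖ ^ (-2 - 2 * β) := by
    have h1 := Real.rpow_le_rpow_of_nonpos hd' hle (show -2 - 2 * β ≤ 0 by linarith)
    rw [Real.mul_rpow (by positivity) hd.le, ← Real.rpow_natCast, ← Real.rpow_mul hR.le] at h1
    calc ‖z - y‖ ^ (-2 - 2 * β) = R ^ (2 * (2 + 2 * β)) *
          (R ^ (((2 : ℕ) : ℝ) * (-2 - 2 * β)) * ‖z - y‖ ^ (-2 - 2 * β)) := by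
          rw [← mul_assoc, ← Real.rpow_add hR]
          rw [show 2 * (2 + 2 * β) + ((2 : ℕ) : ℝ) * (-2 - 2 * β) = 0 by push_cast; ring,
            Real.rpow_zero, one_mul]
      _ ≤ _ := by gcongr
  have hk2 : ‖z - y‖ ^ (-2 - 2 * β) * ‖z - y‖ ^ 2 = ‖z - y‖ ^ (-2 * β) := by
    rw [← Real.rpow_natCast _ 2, ← Real.rpow_add hd]; congr 1; push_cast; ring
  have hw := inv_norm_pow_le hR hz
  have hw' := abs_inv_norm_pow_sub_le hR hy hz
  set a := (‖z‖ ^ 4)⁻¹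
  set b := (‖y‖ ^ 4)⁻¹
  have ha0 : 0 ≤ a := by positivity
  set F := f (circInv z)
  set G := f (circInv y)
  have h1 : (pullback f z - pullback f y) ^ 2 ≤ 2 * (a ^ 2 * (F - G) ^ 2) +
      2 * (G ^ 2 * |a - b| ^ 2) := by
    rw [sq_abs]
    -- The first summand is a difference of `f` with a bounded coefficient. In the second, the
    -- Lipschitz weight gains `‖z - y‖²` after squaring, which leaves the singularity `‖z - y‖ ^ (-2
    -- * β)`, locally integrable for `β < 1`.
    have : pullback f z - pullback f y = a * (F - G) + G * (a - b) := by
      simp only [pullback]; ring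
    rw [this]
    nlinarith [sq_nonneg (a * (F - G) - G * (a - b))]
  calc ‖z - y‖ ^ (-2 - 2 * β) * (pullback f z - pullback f y) ^ 2
      ≤ ‖z - y‖ ^ (-2 - 2 * β) * (2 * (a ^ 2 * (F - G) ^ 2) + 2 * (G ^ 2 * |a - b| ^ 2)) := by
        gcongr
    _ ≤ ‖z - y‖ ^ (-2 - 2 * β) * (2 * ((R ^ 4) ^ 2 * (F - G) ^ 2) +
          2 * (G ^ 2 * (4 * R ^ 5 * ‖z - y‖) ^ 2)) := by
        gcongr
    _ = 2 * R ^ 8 * (‖z - y‖ ^ (-2 - 2 * β) * (F - G) ^ 2) +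
          32 * R ^ 10 * (G ^ 2 * (‖z - y‖ ^ (-2 - 2 * β) * ‖z - y‖ ^ 2)) := by ring
    _ ≤ 2 * R ^ 8 * (R ^ (2 * (2 + 2 * β)) * ‖circInv z - circInv y‖ ^ (-2 - 2 * β) *
          (F - G) ^ 2) + 32 * R ^ 10 * (G ^ 2 * ‖z - y‖ ^ (-2 * β)) := by
        rw [hk2]; gcongr
    _ = _ := by ring

theorem mem_annulus_of_mem_invDisc (hr : 1 < r) {y u : Plane} (hy : y ∈ invDisc r)
    (hu : ‖u‖ ≤ (2 * r)⁻¹) : y + u ∈ annulus (2 * r) := by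
  obtain ⟨h1, h2⟩ := norm_bounds_of_mem_invDisc hr hy
  have h3 : r⁻¹ = 2 * (2 * r)⁻¹ := by field_simp
  have h4 : (2 * r)⁻¹ ≤ 1 := inv_le_one_of_one_le₀ (by linarith)
  constructor
  · have := norm_sub_norm_le y (-u)
    rw [sub_neg_eq_add, norm_neg] at this
    linarith
  · have := norm_add_le y u
    linarith

theorem setLIntegral_closedBall_rpow_ne_top {β δ : ℝ} (hβ1 : β < 1) (hδ : 0 < δ) :
    ∫⁻ u in Metric.closedBall (0 : Plane) δ, ENNReal.ofReal (‖u‖ ^ (-2 * β)) ≠ ⊤ := by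
  have e : ∫⁻ u in Metric.closedBall (0 : Plane) δ, ENNReal.ofReal (‖u‖ ^ (-2 * β)) =
      ∫⁻ u : Plane, (Set.Iic δ).indicator (fun s => ENNReal.ofReal (s ^ (-2 * β))) ‖u‖ := by
    rw [← lintegral_indicator measurableSet_closedBall]
    refine lintegral_congr fun u => ?_
    by_cases h : ‖u‖ ≤ δ <;> simp [h]
  have hm : Measurable ((Set.Iic δ).indicator (fun s : ℝ => ENNReal.ofReal (s ^ (-2 * β)))) :=
    Measurable.indicator (by fun_prop) measurableSet_Iic
  rw [e, lintegral_comp_norm hm]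
  have e2 : ∫⁻ s in Set.Ioi (0 : ℝ), ENNReal.ofReal s *
      (Set.Iic δ).indicator (fun s : ℝ => ENNReal.ofReal (s ^ (-2 * β))) s =
      ∫⁻ s in Set.Ioc 0 δ, ENNReal.ofReal (s ^ (1 - 2 * β)) := by
    rw [← lintegral_indicator measurableSet_Ioi, ← lintegral_indicator measurableSet_Ioc]
    refine lintegral_congr fun s => ?_
    by_cases h0 : 0 < s
    · by_cases h1 : s ≤ δ
      · simp only [Set.indicator_apply, Set.mem_Ioi, Set.mem_Iic, Set.mem_Ioc, h0, h1, and_self,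
          if_true]
        rw [← ENNReal.ofReal_mul h0.le, sub_eq_add_neg, Real.rpow_add h0, Real.rpow_one,
          neg_mul]
      · simp [Set.indicator_apply, h1]
    · simp [Set.indicator_apply, h0]
  rw [e2, setLIntegral_Ioc_rpow hδ (by linarith)]
  finiteness

/-- Restricting to shifts of length at most `(2 * r)⁻¹` keeps both points away from the origin,
where the inversion and the weight `‖y‖⁻⁴` are singular; this is why the local seminorm is used for
the pullback. Inverting both variables then returns to the full seminorm of `f`. -/
theorem exists_localGagliardo_pullback_le {β : ℝ} (hr : 1 < r) (hβ0 : 0 < β) (hβ1 : β < 1) :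
    ∃ C : ℝ≥0∞, C ≠ ⊤ ∧ ∀ f : Plane → ℝ, Measurable f → (∀ x, f x ≠ 0 → x ∈ detectorDisc r) →
      localGagliardo β (2 * r)⁻¹ (pullback f) ≤ C * ((∫⁻ x, ‖f x‖ₑ ^ 2) + gagliardo β f) := by
  set R := 2 * r with hR
  have hR0 : 0 < R := by linarith
  set I := ∫⁻ u in Metric.closedBall (0 : Plane) R⁻¹, ENNReal.ofReal (‖u‖ ^ (-2 * β))
  have hI : I ≠ ⊤ := setLIntegral_closedBall_rpow_ne_top hβ1 (inv_pos.2 hR0)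
  set C1 := ENNReal.ofReal (2 * R ^ 8 * R ^ (2 * (2 + 2 * β)))
  set C2 := ENNReal.ofReal (32 * R ^ 10)
  set M := ENNReal.ofReal (R ^ 4)
  refine ⟨M * (C1 * M) + M * (C2 * I), by finiteness, fun f hm hs => ?_⟩
  have hw := measurable_gagliardoWeight β
  have hci := measurable_circInv
  set E : Plane → Plane → ℝ≥0∞ := fun x y => gagliardoWeight β (y - x) * ‖f y - f x‖ₑ ^ 2
  have hsq : ∀ x : ℝ, ‖x‖ₑ ^ 2 = ENNReal.ofReal (x ^ 2) := fun x => by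
    rw [← ofReal_norm, Real.norm_eq_abs, ← ENNReal.ofReal_pow (abs_nonneg _), sq_abs]
  have hpt : ∀ y, ∀ u ∈ Metric.closedBall (0 : Plane) R⁻¹,
      gagliardoWeight β u * ‖pullback f (y + u) - pullback f y‖ₑ ^ 2 ≤
        (annulus R).indicator (fun y =>
          C1 * (annulus R).indicator (fun z => E (circInv y) (circInv z)) (y + u) +
          C2 * ‖f (circInv y)‖ₑ ^ 2 * ENNReal.ofReal (‖u‖ ^ (-2 * β))) y := by
    intro y u hu
    rw [mem_closedBall_zero_iff] at hu
    by_cases hd : pullback f (y + u) - pullback f y = 0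
    · simp [hd]
    -- A nonzero difference forces one of the two points into the inverted disc, and the other lies
    -- within `R⁻¹` of it.
    have hmem : y ∈ annulus R ∧ y + u ∈ annulus R := by
      by_cases h : pullback f y = 0
      · have h' : pullback f (y + u) ≠ 0 := by simpa [h] using hd
        have h'' := pullback_mem_invDisc hr hs h'
        refine ⟨?_, ?_⟩
        · simpa using mem_annulus_of_mem_invDisc hr h'' (u := -u) (by rwa [norm_neg])
        · simpa using mem_annulus_of_mem_invDisc hr h'' (u := 0) (by simp; linarith)
      · have h'' := pullback_mem_invDisc hr hs h
        refine ⟨?_, mem_annulus_of_mem_invDisc hr h'' hu⟩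
        simpa using mem_annulus_of_mem_invDisc hr h'' (u := 0) (by simp; linarith)
    rw [Set.indicator_of_mem hmem.1, Set.indicator_of_mem hmem.2]
    have h := pullback_diff_le hR0 hβ0 f hmem.1 hmem.2
    rw [add_sub_cancel_left] at h
    have h' := ENNReal.ofReal_le_ofReal h
    simp only [E, gagliardoWeight, hsq, C1, C2]
    rw [ENNReal.ofReal_add (by positivity) (by positivity), ENNReal.ofReal_mul (by positivity),
      ENNReal.ofReal_mul (p := 2 * R ^ 8 * R ^ (2 * (2 + 2 * β))) (by positivity),
      ENNReal.ofReal_mul (p := 32 * R ^ 10) (by positivity),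
      ENNReal.ofReal_mul (p := f (circInv y) ^ 2) (by positivity),
      ENNReal.ofReal_mul (p := ‖circInv (y + u) - circInv y‖ ^ (-2 - 2 * β)) (by positivity)] at h'
    rw [mul_assoc (ENNReal.ofReal (32 * R ^ 10))]
    exact h'
  have hEm : Measurable (Function.uncurry E) := by
    simp only [E, Function.uncurry_def]; fun_prop
  calc localGagliardo β R⁻¹ (pullback f)
      ≤ ∫⁻ y, (annulus R).indicator (fun y => C1 * (M * ∫⁻ z, E (circInv y) z) +
          C2 * ‖f (circInv y)‖ₑ ^ 2 * I) y := by
        refine lintegral_mono fun y => ?_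
        refine (setLIntegral_mono' measurableSet_closedBall (hpt y)).trans ?_
        by_cases hy : y ∈ annulus R
        · simp only [Set.indicator_of_mem hy]
          have hEm' : Measurable fun z => E (circInv y) (circInv z) := by
            simp only [E]; fun_prop
          have hi := hEm'.indicator (measurableSet_annulus R)
          rw [lintegral_add_left (by fun_prop), lintegral_const_mul' _ _ ENNReal.ofReal_ne_top,
            lintegral_const_mul' _ _ (by finiteness)]
          refine add_le_add_left (mul_le_mul_right ?_ _) _
          refine (setLIntegral_le_lintegral _ _).trans ?_
          rw [lintegral_add_left_eq_self, lintegral_indicator (measurableSet_annulus R)]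
          exact setLIntegral_annulus_comp_circInv_le hR0 _
        · simp [Set.indicator_of_notMem hy]
    _ = ∫⁻ y in annulus R, (fun x => C1 * (M * ∫⁻ z, E x z) + C2 * ‖f x‖ₑ ^ 2 * I) (circInv y) :=
        lintegral_indicator (measurableSet_annulus R) _
    _ ≤ M * ∫⁻ x, (C1 * (M * ∫⁻ z, E x z) + C2 * ‖f x‖ₑ ^ 2 * I) :=
        setLIntegral_annulus_comp_circInv_le hR0 _
    _ = M * (C1 * M) * gagliardo β f + M * (C2 * I) * ∫⁻ x, ‖f x‖ₑ ^ 2 := by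
        have hEi : Measurable fun x => ∫⁻ z, E x z := hEm.lintegral_prod_right
        rw [lintegral_add_left (by fun_prop), lintegral_const_mul' _ _ ENNReal.ofReal_ne_top,
          lintegral_const_mul' _ _ ENNReal.ofReal_ne_top, lintegral_mul_const' _ _ hI,
          lintegral_const_mul' _ _ ENNReal.ofReal_ne_top]
        simp only [gagliardo, E]
        ring
    _ ≤ (M * (C1 * M) + M * (C2 * I)) * gagliardo β f +
          (M * (C1 * M) + M * (C2 * I)) * ∫⁻ x, ‖f x‖ₑ ^ 2 := by
        refine add_le_add (mul_le_mul_left le_self_add _) (mul_le_mul_left le_add_self _)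
    _ = _ := by ring

end Transfer

/-! ### Sobolev norms, interpolation, and norm comparison under the pullback. -/

section Sobolev

open FourierTransform

variable {r : ℝ} {f : Plane → ℝ}

theorem fourierHat_eq (f : Plane → ℝ) (ξ : Plane) :
    fourierHat f ((2 * Real.pi) • ξ) =
      (2 * Real.pi : ℂ)⁻¹ * 𝓕 (fun y => (f y : ℂ)) ξ := by
  rw [fourierHat, Real.fourier_eq']
  congr 2; ext x
  rw [smul_eq_mul, mul_comm, real_inner_smul_right]
  congr 2
  push_cast; ring

/-- Under `ξ ↦ 2π ξ` the Jacobian `(2π)²` cancels the squared normalisation of `fourierHat`; the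
weight only grows, since `2π ≥ 1`. -/
theorem lintegral_fourier_le_sobolevNorm_sq {β : ℝ} (hβ0 : 0 < β) (h1 : Integrable f) :
    ∫⁻ ξ, ENNReal.ofReal ((1 + ‖ξ‖ ^ 2) ^ β) * ‖𝓕 (fun y => (f y : ℂ)) ξ‖ₑ ^ 2 ≤
      sobolevNorm β f ^ 2 := by
  have hF : Measurable (𝓕 (fun y => (f y : ℂ))) := (continuous_fourier h1.ofReal).measurable
  have hπ : (0 : ℝ) < 2 * Real.pi := by positivity
  have hhat : ∀ ξ, fourierHat f ξ =
      (2 * Real.pi : ℂ)⁻¹ * 𝓕 (fun y => (f y : ℂ)) ((2 * Real.pi)⁻¹ • ξ) := fun ξ => by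
    rw [← fourierHat_eq, smul_inv_smul₀ hπ.ne']
  have hhatm : Measurable (fourierHat f) := by
    rw [funext hhat]; fun_prop
  set G : Plane → ℝ≥0∞ := fun ξ => ENNReal.ofReal ((1 + ‖ξ‖ ^ 2) ^ β * ‖fourierHat f ξ‖ ^ 2)
  have hG : Measurable G := by fun_prop
  have e1 : sobolevNorm β f ^ 2 = ∫⁻ ξ, G ξ := by
    rw [sobolevNorm, ← ENNReal.rpow_natCast, ← ENNReal.rpow_mul]
    norm_num
    rfl
  have e2 : ∫⁻ ξ, G ξ = ENNReal.ofReal ((2 * Real.pi) ^ 2) * ∫⁻ ξ, G ((2 * Real.pi) • ξ) := by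
    rw [← lintegral_map hG (by fun_prop : Measurable fun ξ : Plane => (2 * Real.pi) • ξ),
      Measure.map_addHaar_smul volume hπ.ne', lintegral_smul_measure, finrank_euclideanSpace_fin,
      smul_eq_mul, ← mul_assoc, ← ENNReal.ofReal_mul (by positivity), abs_of_pos (by positivity),
      mul_inv_cancel₀ (by positivity), ENNReal.ofReal_one, one_mul]
  rw [e1, e2, ← lintegral_const_mul' _ _ ENNReal.ofReal_ne_top]
  refine lintegral_mono fun ξ => ?_
  simp only [G]
  rw [← ofReal_norm, ← ENNReal.ofReal_pow (norm_nonneg _), ← ENNReal.ofReal_mul (by positivity),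
    ← ENNReal.ofReal_mul (by positivity)]
  refine ENNReal.ofReal_le_ofReal ?_
  have h3 : ‖(2 * Real.pi : ℂ)⁻¹‖ = (2 * Real.pi)⁻¹ := by
    rw [norm_inv, norm_mul, Complex.norm_real, Real.norm_of_nonneg Real.pi_pos.le]
    norm_num
  rw [fourierHat_eq, norm_mul, h3, norm_smul, Real.norm_of_nonneg hπ.le]
  have h4 : ‖ξ‖ ≤ 2 * Real.pi * ‖ξ‖ :=
    le_mul_of_one_le_left (norm_nonneg _) (by linarith [Real.pi_gt_three])
  calc (1 + ‖ξ‖ ^ 2) ^ β * ‖𝓕 (fun y => (f y : ℂ)) ξ‖ ^ 2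
      ≤ (1 + (2 * Real.pi * ‖ξ‖) ^ 2) ^ β * ‖𝓕 (fun y => (f y : ℂ)) ξ‖ ^ 2 := by gcongr
    _ = _ := by field_simp

/-- Interpolation between Sobolev norms of negative and positive order. -/
theorem lintegral_interpolation {F : Plane → ℝ≥0∞} (hF : Measurable F) {α β : ℝ} (hα : 0 < α)
    (hβ : 0 < β) :
    ∫⁻ ξ, F ξ ≤ (∫⁻ ξ, ENNReal.ofReal ((1 + ‖ξ‖ ^ 2) ^ (-α)) * F ξ) ^ (β / (β + α)) *
      (∫⁻ ξ, ENNReal.ofReal ((1 + ‖ξ‖ ^ 2) ^ β) * F ξ) ^ (α / (β + α)) := by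
  have ha : 0 ≤ β / (β + α) := by positivity
  have hb : 0 ≤ α / (β + α) := by positivity
  have hab : β / (β + α) + α / (β + α) = 1 := by field_simp
  refine le_of_eq_of_le (lintegral_congr fun ξ => ?_)
    (ENNReal.lintegral_mul_norm_pow_le (f := fun ξ => ENNReal.ofReal ((1 + ‖ξ‖ ^ 2) ^ (-α)) * F ξ)
      (g := fun ξ => ENNReal.ofReal ((1 + ‖ξ‖ ^ 2) ^ β) * F ξ) (by fun_prop) (by fun_prop) ha hb hab)
  have hq : 0 < 1 + ‖ξ‖ ^ 2 := by positivity
  rw [ENNReal.mul_rpow_of_nonneg _ _ ha, ENNReal.mul_rpow_of_nonneg _ _ hb,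
    ENNReal.ofReal_rpow_of_pos (by positivity), ENNReal.ofReal_rpow_of_pos (by positivity),
    ← Real.rpow_mul hq.le, ← Real.rpow_mul hq.le, mul_mul_mul_comm,
    ← ENNReal.ofReal_mul (by positivity), ← Real.rpow_add hq,
    ← ENNReal.rpow_add_of_nonneg _ _ ha hb, hab, ENNReal.rpow_one]
  rw [show -α * (β / (β + α)) + β * (α / (β + α)) = 0 by ring, Real.rpow_zero, ENNReal.ofReal_one,
    one_mul]

theorem norm_bounds_of_mem_detectorDisc (hr : 1 < r) {x : Plane} (hx : x ∈ detectorDisc r) :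
    1 < ‖x‖ ∧ ‖x‖ < r := by
  have h := norm_bounds_of_mem_invDisc hr ((circInv_mem_invDisc_iff (by linarith) x).2 hx)
  rw [norm_circInv] at h
  have h0 : 0 < ‖x‖ := inv_pos.1 ((inv_pos.2 (by linarith)).trans h.1)
  exact ⟨(inv_lt_one₀ h0).1 h.2, (inv_lt_inv₀ (by linarith) h0).1 h.1⟩

theorem mem_annulus_of_one_lt (hr : 1 < r) {x : Plane} (h : 1 < ‖x‖ ∧ ‖x‖ < r) :
    x ∈ annulus r :=
  ⟨(inv_le_one_of_one_le₀ hr.le).trans h.1.le, h.2.le⟩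

theorem mem_annulus_of_pullback_ne_zero (hr : 1 < r) (hs : ∀ x, f x ≠ 0 → x ∈ detectorDisc r)
    {y : Plane} (hy : pullback f y ≠ 0) : y ∈ annulus r := by
  have h := norm_bounds_of_mem_invDisc hr (pullback_mem_invDisc hr hs hy)
  exact ⟨h.1.le, h.2.le.trans hr.le⟩

theorem lintegral_pullback_le (hr : 1 < r) (hs : ∀ x, f x ≠ 0 → x ∈ detectorDisc r) {n : ℕ}
    (hn : n ≠ 0) :
    ∫⁻ y, ‖pullback f y‖ₑ ^ n ≤
      ENNReal.ofReal (r ^ 4) ^ n * ENNReal.ofReal (r ^ 4) * ∫⁻ x, ‖f x‖ₑ ^ n := by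
  have hr0 : 0 < r := by linarith
  calc ∫⁻ y, ‖pullback f y‖ₑ ^ n
      = ∫⁻ y in annulus r, ‖pullback f y‖ₑ ^ n := by
        refine (setLIntegral_eq_of_support_subset ?_).symm
        intro y hy
        refine mem_annulus_of_pullback_ne_zero hr hs fun h => hy ?_
        simp [h, hn]
    _ ≤ ∫⁻ y in annulus r, ENNReal.ofReal (r ^ 4) ^ n * ‖f (circInv y)‖ₑ ^ n := by
        refine setLIntegral_mono' (measurableSet_annulus r) fun y hy => ?_
        rw [pullback, enorm_mul, mul_pow]
        gcongr
        rw [← ofReal_norm, Real.norm_of_nonneg (by positivity)]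
        exact ENNReal.ofReal_le_ofReal (inv_norm_pow_le hr0 hy)
    _ ≤ _ := by
        rw [lintegral_const_mul' _ _ (by finiteness), mul_assoc]
        exact mul_le_mul_right (setLIntegral_annulus_comp_circInv_le hr0 fun x => ‖f x‖ₑ ^ n) _

/-- At `circInv x` the pullback is `‖x‖⁴ f x`, and `‖x‖ > 1` on the detector disc. -/
theorem lintegral_sq_le_pullback (hr : 1 < r) (hs : ∀ x, f x ≠ 0 → x ∈ detectorDisc r) :
    ∫⁻ x, ‖f x‖ₑ ^ 2 ≤ ENNReal.ofReal (r ^ 4) * ∫⁻ y, ‖pullback f y‖ₑ ^ 2 := by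
  calc ∫⁻ x, ‖f x‖ₑ ^ 2
      = ∫⁻ x in annulus r, ‖f x‖ₑ ^ 2 := by
        refine (setLIntegral_eq_of_support_subset ?_).symm
        intro x hx
        refine mem_annulus_of_one_lt hr (norm_bounds_of_mem_detectorDisc hr (hs x fun h => hx ?_))
        simp [h]
    _ ≤ ∫⁻ x in annulus r, ‖pullback f (circInv x)‖ₑ ^ 2 := by
        refine lintegral_mono fun x => ?_
        by_cases hx : f x = 0
        · simp [hx]
        have h := norm_bounds_of_mem_detectorDisc hr (hs x hx)
        dsimp only
        gcongr
        rw [pullback, circInv_circInv, norm_circInv, ← ofReal_norm, ← ofReal_norm, norm_mul]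
        refine ENNReal.ofReal_le_ofReal (le_mul_of_one_le_left (norm_nonneg _) ?_)
        rw [inv_pow, inv_inv, Real.norm_of_nonneg (by positivity)]
        exact one_le_pow₀ h.1.le
    _ ≤ _ := setLIntegral_annulus_comp_circInv_le (by linarith) fun x => ‖pullback f x‖ₑ ^ 2

theorem integrable_pullback (hr : 1 < r) (hm : Measurable f) (h1 : Integrable f)
    (hs : ∀ x, f x ≠ 0 → x ∈ detectorDisc r) : Integrable (pullback f) := by
  refine ⟨(measurable_pullback hm).aestronglyMeasurable, ?_⟩
  have h := lintegral_pullback_le hr hs one_ne_zero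
  simp only [pow_one] at h
  exact h.trans_lt (ENNReal.mul_lt_top (by finiteness) h1.2)

theorem memLp_two_pullback (hr : 1 < r) (hm : Measurable f) (h2 : MemLp f 2)
    (hs : ∀ x, f x ≠ 0 → x ∈ detectorDisc r) : MemLp (pullback f) 2 := by
  refine ⟨(measurable_pullback hm).aestronglyMeasurable, ?_⟩
  have h := lintegral_pullback_le hr hs two_ne_zero
  rw [← eLpNorm_two_sq, ← eLpNorm_two_sq] at h
  have h3 := h2.2
  exact (ENNReal.pow_lt_top_iff.1 (h.trans_lt (by finiteness))).resolve_right two_ne_zero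

/-- The chain is: `H^β` norm of the pullback, its local Gagliardo seminorm, the full seminorm of
`f`, the `H^β` norm of `f`; `L²` terms are absorbed because the weight is at least `1`. -/
theorem exists_sobolev_pullback_le {β : ℝ} (hr : 1 < r) (hβ0 : 0 < β) (hβ1 : β < 1) :
    ∃ C : ℝ≥0∞, C ≠ ⊤ ∧ ∀ f : Plane → ℝ, Measurable f → Integrable f → MemLp f 2 →
      (∀ x, f x ≠ 0 → x ∈ detectorDisc r) →
      ∫⁻ ξ, ENNReal.ofReal ((1 + ‖ξ‖ ^ 2) ^ β) * ‖𝓕 (fun y => (pullback f y : ℂ)) ξ‖ₑ ^ 2 ≤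
        C * ∫⁻ ξ, ENNReal.ofReal ((1 + ‖ξ‖ ^ 2) ^ β) * ‖𝓕 (fun y => (f y : ℂ)) ξ‖ₑ ^ 2 := by
  obtain ⟨C1, hC1, H1⟩ := exists_lintegral_fourier_le_localGagliardo hβ0 hβ1
    (δ := (2 * r)⁻¹) (by positivity)
  obtain ⟨C2, hC2, H2⟩ := exists_localGagliardo_pullback_le hr hβ0 hβ1
  obtain ⟨C3, hC3, H3⟩ := exists_gagliardo_le hβ0 hβ1
  set C0 := ENNReal.ofReal (r ^ 4) ^ 2 * ENNReal.ofReal (r ^ 4)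
  refine ⟨C1 * (C0 + C2 * (1 + C3)), by finiteness, fun f hm h1 h2 hs => ?_⟩
  set S := ∫⁻ ξ, ENNReal.ofReal ((1 + ‖ξ‖ ^ 2) ^ β) * ‖𝓕 (fun y => (f y : ℂ)) ξ‖ₑ ^ 2 with hS
  have hL2 : ∫⁻ x, ‖f x‖ₑ ^ 2 ≤ S := by
    have e : ∫⁻ x, ‖f x‖ₑ ^ 2 = ∫⁻ x, ‖(f x : ℂ)‖ₑ ^ 2 := lintegral_congr fun x => by
      rw [← ofReal_norm, ← ofReal_norm, Complex.norm_real]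
    rw [e, ← lintegral_enorm_fourier_sq (F := fun y => (f y : ℂ)) h1.ofReal h2.ofReal]
    refine lintegral_mono fun ξ => le_mul_of_one_le_left zero_le ?_
    rw [ENNReal.one_le_ofReal]
    exact Real.one_le_rpow (by linarith [sq_nonneg ‖ξ‖]) hβ0.le
  calc _ ≤ C1 * ((∫⁻ x, ‖pullback f x‖ₑ ^ 2) + localGagliardo β (2 * r)⁻¹ (pullback f)) :=
        H1 _ (measurable_pullback hm) (integrable_pullback hr hm h1 hs)
          (memLp_two_pullback hr hm h2 hs)
    _ ≤ C1 * (C0 * S + C2 * (S + C3 * S)) := by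
        refine mul_le_mul_right (add_le_add ?_ ?_) _
        · exact (lintegral_pullback_le hr hs two_ne_zero).trans (mul_le_mul_right hL2 _)
        · exact (H2 f hm hs).trans (mul_le_mul_right (add_le_add hL2 (H3 f hm h1 h2)) _)
    _ = _ := by ring

theorem lintegral_cylinderMeasure {F : ℝ × ℝ → ℝ≥0∞} (hF : Measurable F) :
    ∫⁻ z, F z ∂cylinderMeasure =
      ∫⁻ φ in Set.Ioo 0 (2 * Real.pi), ∫⁻ p in Set.Icc (-1 : ℝ) 1, F (p, φ) := by
  rw [cylinderMeasure, Measure.volume_eq_prod, ← Measure.prod_restrict,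
    lintegral_prod_symm _ hF.aemeasurable, restrict_Ioo_eq_restrict_Icc]

instance : IsFiniteMeasure cylinderMeasure := by
  unfold cylinderMeasure
  refine isFiniteMeasure_restrict.2 ?_
  rw [Measure.volume_eq_prod, Measure.prod_prod]
  exact ENNReal.mul_ne_top measure_Icc_lt_top.ne measure_Icc_lt_top.ne

end Sobolev

end DiscTransform

/-! ### The stability estimate. -/

open DiscTransform FourierTransform in
theorem theorem2 (r : ℝ) (hr : 1 < r) (β : ℝ) (hβ0 : 0 < β) (hβ1 : β < 1) :
    ∃ c : ℝ, 0 < c ∧ ∀ (f : DiscTransform.Plane → ℝ) (ρ : ℝ),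
      DiscTransform.IsTestFunction (DiscTransform.detectorDisc r) f →
      0 ≤ ρ →
      DiscTransform.sobolevNorm β f ≤ ENNReal.ofReal ρ →
        MemLp (fun z : ℝ × ℝ => DiscTransform.discTransform f z.1 z.2) 2
            DiscTransform.cylinderMeasure ∧
        eLpNorm f 2 volume ≤
          ENNReal.ofReal (c * ρ ^ ((3 / 2) / (β + 3 / 2))) *
            eLpNorm (fun z : ℝ × ℝ => DiscTransform.discTransform f z.1 z.2) 2
              DiscTransform.cylinderMeasure ^ (β / (β + 3 / 2)) := by
  obtain ⟨C1, hC1, H1⟩ := exists_lintegral_fourier_le hr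
  obtain ⟨C2, hC2, H2⟩ := exists_sobolev_pullback_le hr hβ0 hβ1
  set a := β / (β + 3 / 2)
  set b := (3 / 2) / (β + 3 / 2)
  have ha : 0 ≤ a := by positivity
  have hb : 0 ≤ b := by positivity
  -- The estimates are for squared norms, hence the square root. The `+ 1` in the witness below
  -- makes the constant positive without examining `K`.
  set K : ℝ≥0∞ := (ENNReal.ofReal (r ^ 4) * (C1 ^ a * C2 ^ b)) ^ (1 / 2 : ℝ)
  have hK : K ≠ ⊤ := by finiteness
  refine ⟨K.toReal + 1, by positivity, fun f ρ hf hρ hS => ?_⟩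
  obtain ⟨hsmooth, hcs, hts⟩ := hf
  have hm : Measurable f := hsmooth.continuous.measurable
  have h1 : Integrable f := hsmooth.continuous.integrable_of_hasCompactSupport hcs
  have h2 : MemLp f 2 := hsmooth.continuous.memLp_of_hasCompactSupport hcs
  have hs : ∀ x, f x ≠ 0 → x ∈ detectorDisc r := fun x hx => hts (subset_tsupport f hx)
  have hgm := measurable_pullback hm
  have hg1 := integrable_pullback hr hm h1 hs
  have hg2 := memLp_two_pullback hr hm h2 hs
  have hgs : ∀ y, pullback f y ≠ 0 → y ∈ invDisc r := fun y hy => pullback_mem_invDisc hr hs hy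
  have hD : (fun z : ℝ × ℝ => discTransform f z.1 z.2) =
      fun z => halfPlaneTransform (pullback f) z.1 z.2 :=
    funext fun z => discTransform_eq_halfPlaneTransform h1 z.1 z.2
  rw [hD]
  have hHm := measurable_halfPlaneTransform hgm
  refine ⟨MemLp.of_bound hHm.aestronglyMeasurable (∫ y, |pullback f y|)
    (Eventually.of_forall fun z => abs_halfPlaneTransform_le hg1 z.1 z.2), ?_⟩
  set D := eLpNorm (fun z : ℝ × ℝ => halfPlaneTransform (pullback f) z.1 z.2) 2 cylinderMeasure
  have hD2 : D ^ 2 = ∫⁻ φ in Set.Ioo 0 (2 * Real.pi), ∫⁻ p in Set.Icc (-1 : ℝ) 1,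
      ‖halfPlaneTransform (pullback f) p φ‖ₑ ^ 2 := by
    rw [eLpNorm_two_sq, lintegral_cylinderMeasure (by fun_prop)]
  have hF : Measurable (𝓕 (fun y => (pullback f y : ℂ))) :=
    (continuous_fourier hg1.ofReal).measurable
  have hX := H1 _ hg1 hgm hgs
  rw [← hD2] at hX
  have hY := (H2 f hm h1 h2 hs).trans (mul_le_mul_right
    ((lintegral_fourier_le_sobolevNorm_sq hβ0 h1).trans (pow_le_pow_left' hS 2)) C2)
  have hmain : eLpNorm f 2 volume ^ 2 ≤
      ENNReal.ofReal (r ^ 4) * ((C1 * D ^ 2) ^ a * (C2 * ENNReal.ofReal ρ ^ 2) ^ b) := by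
    rw [eLpNorm_two_sq]
    refine (lintegral_sq_le_pullback hr hs).trans (mul_le_mul_right ?_ _)
    have e : ∫⁻ y, ‖pullback f y‖ₑ ^ 2 = ∫⁻ y, ‖(pullback f y : ℂ)‖ₑ ^ 2 :=
      lintegral_congr fun x => by rw [← ofReal_norm, ← ofReal_norm, Complex.norm_real]
    rw [e, ← lintegral_enorm_fourier_sq (F := fun y => (pullback f y : ℂ)) hg1.ofReal hg2.ofReal]
    -- Interpolation with `α = 3/2`, matching the order lost by the half-plane transform.
    refine (lintegral_interpolation (by fun_prop) (α := 3 / 2) (by norm_num) hβ0).trans ?_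
    exact mul_le_mul' (ENNReal.rpow_le_rpow hX ha) (ENNReal.rpow_le_rpow hY hb)
  have hK2 : K ^ 2 = ENNReal.ofReal (r ^ 4) * (C1 ^ a * C2 ^ b) := by
    rw [← ENNReal.rpow_natCast, ← ENNReal.rpow_mul]
    norm_num
  have hcomm : ∀ (x : ℝ≥0∞) (q : ℝ), (x ^ 2) ^ q = (x ^ q) ^ 2 := fun x q => by
    rw [← ENNReal.rpow_natCast, ← ENNReal.rpow_natCast, ← ENNReal.rpow_mul, ← ENNReal.rpow_mul,
      mul_comm]
  have hsq : eLpNorm f 2 volume ^ 2 ≤ (K * ENNReal.ofReal ρ ^ b * D ^ a) ^ 2 := by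
    refine hmain.trans_eq ?_
    rw [ENNReal.mul_rpow_of_nonneg _ _ ha, ENNReal.mul_rpow_of_nonneg _ _ hb, hcomm, hcomm,
      mul_pow, mul_pow, hK2]
    ring
  have hle : eLpNorm f 2 volume ≤ K * ENNReal.ofReal ρ ^ b * D ^ a :=
    (ENNReal.pow_le_pow_left_iff two_ne_zero).1 hsq
  refine hle.trans (mul_le_mul_left ?_ _)
  rw [ENNReal.ofReal_mul (by positivity), ENNReal.ofReal_rpow_of_nonneg hρ hb]
  refine mul_le_mul_left ?_ _
  rw [ENNReal.le_ofReal_iff_toReal_le hK (by positivity)]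
  linarith
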